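/- Let $G=(V,E)$ be a finite connected simple graph with $n=|V|$ vertices and maximum degree $D$, each vertex carrying a qudit $\mathbb{C}^q$, and let $\mathcal{H}_V=\bigotimes_{v\in V}\mathbb{C}^q$. For edges $e,e'\in E$ let $\operatorname{dist}(e,e')=0$ if $e=e'$, and otherwise let $\operatorname{dist}(e,e')$ be one plus the least graph distance between an endpoint of $e$ and an endpoint of $e'$ (so distinct edges sharing a vertex are at distance $1$). Suppose that $E$ has spatial dimension $\delta\ge 1$ with constant $M>0$: $|\{e'\in E:\operatorname{dist}(e,e')=k\}|\le M k^{\delta-1}$ for all $e\in E$ and all integers $k\ge1$. Let $H(t)=\sum_{e\in E}\alpha_e(t)H_e$, where each $H_e$ is self-adjoint, acts non-trivially only on the two endpoints of $e$ and satisfies $\|H_e\|_\infty\le\frac12$, and the $\alpha_e$ are real measurable functions with $|\alpha_e(t)|\le b<\infty$ for all $e\in E$ and $t\ge0$ (for instance $b=\sup_{e,t}|\alpha_e(t)|$). Let $U(t)$, $t\ge0$, be the unitary evolution it generates, i.e. the continuous solution of $U(t)=\mathbb{I}-i\int_0^tH(s)U(s)\,ds$. Set $v:=e\,b\,(2D-1)$,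 where here $e$ is Euler's number. Fix any vertex $v_0$ and label the vertices $1,\dots,n$ in order of non-decreasing graph distance to $v_0$, with $v_0$ labelled $1$. Let $d(i):=\operatorname{dist}(\{1\},\{i,\dots,n\})$, and let $i_0$ be the first label with $d(i_0)\ge2\delta-1$ ($i_0:=n+1$ if there is none). For self-adjoint $O$ on $\mathcal{H}_V$ let $\|O\|_L:=2\max_{w\in V}\min_{O_{w^c}}\|O-O_{w^c}\otimes\mathbb{I}_w\|_\infty$, the minimum being over self-adjoint $O_{w^c}$ on $\bigotimes_{u\ne w}\mathbb{C}^q$, and for a state $\sigma$ let $\operatorname{Var}_\sigma(O):=\operatorname{tr}[\sigma\,|O-\operatorname{tr}[\sigma O]\,\mathbb{I}|^2]$. Then for every product state $\rho=\bigotimes_{w\in V}\rho_w$ and every $t\ge0$ the output state $\sigma_t=U(t)\rho U(t)^\dagger$ satisfies a $(2,\infty)$-Poincaré inequality, $\operatorname{Var}_{\sigma_t}(O)\le C_t\,|V|\,\|O\|_L^2$ for all self-adjoint $O$, with a constant $C_t>0$ such that $$C_t\le 4\Big(2(i_0-1)+\frac{4M}{2D-1}\sum_{i=i_0}^{n}d(i)^{\delta-1}e^{vt-d(i)}\Big)^2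 .$$ -/

import Mathlib

open scoped Matrix ComplexOrder

noncomputable section

namespace LocalQuantum

/-- Operators on `⨂_{v ∈ V} ℂ^q`, as matrices in the computational basis `V → Fin q`. -/
abbrev Op (V : Type*) (q : ℕ) := Matrix (V → Fin q) (V → Fin q) ℂ

section Operators

variable {V : Type*} [Fintype V] [DecidableEq V] {q : ℕ}

/-- The operator norm `‖X‖_∞` with respect to the Hilbert space norm. -/
def opNorm (X : Op V q) : ℝ :=
  ‖Matrix.toEuclideanCLM (n := V → Fin q) (𝕜 := ℂ) X‖

/-- `X` acts only on the subsystem `A`, that is `X = h ⊗ 𝕀` with `h` an operator on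
`⨂_{v ∈ A} ℂ^q` and `𝕀` the identity on the complement of `A`. -/
def ActsOn (X : Op V q) (A : Set V) : Prop :=
  ∃ h : Matrix (A → Fin q) (A → Fin q) ℂ, ∀ σ τ : V → Fin q,
    ((∀ w, w ∉ A → σ w = τ w) → X σ τ = h (fun w => σ w) (fun w => τ w)) ∧
    (¬ (∀ w, w ∉ A → σ w = τ w) → X σ τ = 0)

/-- `2 min ‖O - X‖_∞` over the self-adjoint `X` that do not act on `v`. -/
def siteOscillation (v : V) (O : Op V q) : ℝ :=
  2 * ⨅ X : {X : Op V q // X.IsHermitian ∧ ActsOn X {v}ᶜ}, opNorm (O - X.1)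

/-- The quantum Lipschitz constant `‖O‖_L`. -/
def lipschitzConst (O : Op V q) : ℝ :=
  ⨆ v : V, siteOscillation v O

/-- The variance `tr[ω |O - tr[ω O] 𝕀|²]`, where `|A|² = A† A`. -/
def variance (ω O : Op V q) : ℝ :=
  (ω * ((O - (ω * O).trace • (1 : Op V q))ᴴ * (O - (ω * O).trace • (1 : Op V q)))).trace.re

/-- The state `σ` satisfies a `(2,∞)`-Poincaré inequality of constant `C > 0`. -/
def PoincareTwoInfty (σ : Op V q) (C : ℝ) : Prop :=
  0 < C ∧ ∀ O : Op V q, O.IsHermitian →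
    variance σ O ≤ C * (Fintype.card V : ℝ) * lipschitzConst O ^ 2

/-- A density matrix: positive semidefinite of trace one. -/
def IsState {ι : Type*} [Fintype ι] (ρ : Matrix ι ι ℂ) : Prop :=
  ρ.PosSemidef ∧ ρ.trace = 1

/-- `ρ = ⨂_v ρ_v` with each `ρ_v` a one-qudit state. -/
def IsProductState (ρ : Op V q) : Prop :=
  ∃ r : V → Matrix (Fin q) (Fin q) ℂ, (∀ v, IsState (r v)) ∧
    ∀ σ τ : V → Fin q, ρ σ τ = ∏ v, r v (σ v) (τ v)

/-- The state `U ρ U†`. -/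
def evolve (U ρ : Op V q) : Op V q := U * ρ * Uᴴ

end Operators

section Dynamics

variable {V : Type*} [Fintype V] [DecidableEq V] {q : ℕ}

/-- `H(t) = ∑_{e ∈ E} α_e(t) H_e`. -/
def hamiltonian (G : SimpleGraph V) [DecidableRel G.Adj] (h : Sym2 V → Op V q)
    (α : Sym2 V → ℝ → ℝ) (t : ℝ) : Op V q :=
  ∑ e ∈ G.edgeFinset, (α e t : ℂ) • h e

/-- `U` is the unitary evolution generated by `H` on `[0, ∞)`: the continuous solution of
`U(t) = 𝕀 - i ∫₀ᵗ H(s) U(s) ds`, the integrated form of `U' = -i H U`, `U(0) = 𝕀`, which also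
makes sense when `H` is not continuous in time. -/
structure IsUnitaryEvolution (H U : ℝ → Op V q) : Prop where
  unitary : ∀ t, 0 ≤ t → U t ∈ Matrix.unitaryGroup (V → Fin q) ℂ
  continuousOn : ∀ σ τ, ContinuousOn (fun t => U t σ τ) (Set.Ici 0)
  schrodinger : ∀ t, 0 ≤ t → ∀ σ τ,
    U t σ τ = (1 : Op V q) σ τ - Complex.I * ∫ s in (0 : ℝ)..t, (H s * U s) σ τ

/-- A continuous-time local quantum process on `G`, with local terms `h`, time-dependent
couplings `α` of absolute value at most `b`, and unitary evolution `U`. -/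
structure IsLocalProcess (G : SimpleGraph V) [DecidableRel G.Adj] (h : Sym2 V → Op V q)
    (α : Sym2 V → ℝ → ℝ) (b : ℝ) (U : ℝ → Op V q) : Prop where
  selfAdjoint : ∀ e ∈ G.edgeSet, (h e).IsHermitian
  actsOn : ∀ e ∈ G.edgeSet, ActsOn (h e) {v | v ∈ e}
  norm_le : ∀ e ∈ G.edgeSet, opNorm (h e) ≤ 1 / 2
  measurable : ∀ e ∈ G.edgeSet, Measurable (α e)
  coupling_le : ∀ e ∈ G.edgeSet, ∀ t, 0 ≤ t → |α e t| ≤ b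
  evolution : IsUnitaryEvolution (hamiltonian G h α) U

end Dynamics

section Geometry

variable {V : Type*}

open Classical in
/-- The distance between edges: `0` if they are equal; otherwise one more than the least distance
between an endpoint of the first and an endpoint of the second, so that distinct edges with a
common vertex are at distance one. -/
def edgeDist (G : SimpleGraph V) (e e' : Sym2 V) : ℕ :=
  if e = e' then 0 else sInf {k | ∃ x ∈ e, ∃ y ∈ e', k = G.dist x y + 1}

/-- The sphere `S_e(k)` of edges at distance `k` from the edge `e`. -/
def edgeSphere (G : SimpleGraph V) (e : Sym2 V) (k : ℕ) : Set (Sym2 V) :=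
  {e' | e' ∈ G.edgeSet ∧ edgeDist G e e' = k}

/-- The edge set has spatial dimension `δ` with constant `M`. -/
def HasSpatialDim (G : SimpleGraph V) (δ M : ℝ) : Prop :=
  ∀ e ∈ G.edgeSet, ∀ k : ℕ, 1 ≤ k → ((edgeSphere G e k).ncard : ℝ) ≤ M * (k : ℝ) ^ (δ - 1)

/-- The enumeration `x 0, …, x (n-1)` orders the vertices by their distance to `x 0 = v₀`; the
vertex `x k` carries the label `k + 1 ∈ {1, …, n}`. -/
def IsDistanceOrdering (G : SimpleGraph V) (v₀ : V) {n : ℕ} (x : Fin n ≃ V) : Prop :=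
  (∀ k : Fin n, (k : ℕ) = 0 → x k = v₀) ∧
    ∀ j k : Fin n, j ≤ k → G.dist v₀ (x j) ≤ G.dist v₀ (x k)

/-- `d(i) = dist({1}, {i, …, n})`. -/
def labelDist (G : SimpleGraph V) (v₀ : V) {n : ℕ} (x : Fin n ≃ V) (i : ℕ) : ℕ :=
  sInf {m | ∃ k : Fin n, i ≤ (k : ℕ) + 1 ∧ m = G.dist v₀ (x k)}

/-- `i₀`, the first label `i ∈ {1, …, n}` with `d(i) ≥ 2δ - 1`, and `n + 1` if there is none. -/
def firstFarLabel (G : SimpleGraph V) (v₀ : V) {n : ℕ} (x : Fin n ≃ V) (δ : ℝ) : ℕ :=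
  sInf ({i | 1 ≤ i ∧ i ≤ n ∧ 2 * δ - 1 ≤ (labelDist G v₀ x i : ℝ)} ∪ {n + 1})

/-- The Lieb–Robinson velocity `v = e b (2D - 1)`. -/
def lrVelocity (D : ℕ) (b : ℝ) : ℝ := Real.exp 1 * b * (2 * (D : ℝ) - 1)

end Geometry

end LocalQuantum

end

/-!
The evolved observable `O' = U(t)† O U(t)` has the same variance in the product state `ρ` as `O` has
in `U(t) ρ U(t)†`, so it suffices to bound the distance of `O'` from the operators which are trivial
at a given site.

*Product states.* In the GNS inner product `tr[ρ A† B]` of a product state, the partial average of a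
site in its own state is the orthogonal projection onto the operators trivial at that site, and
these projections commute. Their product over all sites maps `O'` to its expectation, whence the
Efron–Stein bound `Var_ρ(O') ≤ ∑_w ‖O' - X_w‖²` for arbitrary `X_w` trivial at `w`
(`variance_tensor_le`).

*Dynamics.* Twirling the site `w` with a unitary one-design yields an `X_w` with
`‖O' - X_w‖ ≤ max_u ‖[u, O']‖`, over unitaries `u` at `w` (`norm_sub_twirl_le_of_commutator`). For
`K` supported on an edge the commutator `[K, O]` is at most `3 ‖O‖_L ‖K‖`
(`norm_commutator_le_lipschitzConst`). Along `f(s) = U(s) O' U(s)†`, which joins `O'` at `s = 0` to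
`O` at `s = t`, the terms of `H` commuting with `K` only conjugate `[K, f(s)]`, and the others lie on
at most `2D - 1` edges, so the commutators grow at most by the factor `y = e^{b(2D-1)t}`. Since `H` is
only measurable in time, the growth is obtained from time steps with an error of second order
(`CommutatorBound.step`, `IsLocalProcess.commutatorBound`) rather than from a derivative. Altogether
the Poincaré constant `(3y)²` is admissible. The constant `n²` is admissible too, because `O` is at
distance at most `n ‖O‖_L` from the scalars.

*Comparison with the stated bound.* The velocity exceeds the growth rate `b(2D-1)` by the factor
`e`, so that `e^{vt} ≥ y²`. If there is a far label, let `d` be its distance: then `i₀ - 1 ≥ d` and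
`d ≤ 2δ` since the distances from `v₀` have no gaps, and `M ≥ D - 1`. The term `i = i₀` alone,
together with `2(i₀ - 1)`, dominates `3y / 2`, because `d^δ e^{-d} ≥ d^{d/2} e^{-d} ≥ e^{-e/2}`
(`three_mul_le`). For this reason no spatial decay of commutators is needed, and `v₀` may be any
vertex. If there is no far label, or if `D ≤ 1`, which forces `n ≤ 2`, the constant `n²` suffices.
-/

noncomputable section

namespace LocalQuantum

/-! ### Product operators and operators trivial at a site -/

section TensorProducts

variable {V : Type*} [Fintype V] [DecidableEq V] {q : ℕ}

/-- The product operator `⨂_v B_v`. -/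
def tensor (B : V → Matrix (Fin q) (Fin q) ℂ) : Op V q :=
  Matrix.of fun σ τ => ∏ v, B v (σ v) (τ v)

omit [DecidableEq V] in
theorem tensor_apply (B : V → Matrix (Fin q) (Fin q) ℂ) (σ τ : V → Fin q) :
    tensor B σ τ = ∏ v, B v (σ v) (τ v) := rfl

theorem tensor_mul (A B : V → Matrix (Fin q) (Fin q) ℂ) :
    tensor A * tensor B = tensor (A * B) := by
  ext σ τ
  simp only [Matrix.mul_apply, tensor_apply, Pi.mul_apply, Finset.prod_univ_sum,
    Fintype.piFinset_univ, Finset.prod_mul_distrib]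

omit [DecidableEq V] in
theorem tensor_one : tensor (1 : V → Matrix (Fin q) (Fin q) ℂ) = 1 := by
  ext σ τ
  rw [tensor_apply]
  by_cases h : σ = τ
  · subst h; simp
  · obtain ⟨v, hv⟩ := Function.ne_iff.1 h
    rw [Matrix.one_apply_ne h]
    exact Finset.prod_eq_zero (Finset.mem_univ v) (by simp [Matrix.one_apply_ne hv])

omit [DecidableEq V] in
theorem tensor_conjTranspose (B : V → Matrix (Fin q) (Fin q) ℂ) :
    (tensor B)ᴴ = tensor fun v => (B v)ᴴ := by
  ext σ τ
  simp [tensor_apply, Matrix.conjTranspose_apply]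

theorem tensor_update_apply (B : V → Matrix (Fin q) (Fin q) ℂ) (w : V)
    (A : Matrix (Fin q) (Fin q) ℂ) (σ τ : V → Fin q) :
    tensor (Function.update B w A) σ τ =
      A (σ w) (τ w) * ∏ v ∈ Finset.univ.erase w, B v (σ v) (τ v) := by
  rw [tensor_apply, ← Finset.mul_prod_erase _ _ (Finset.mem_univ w), Function.update_self]
  congr 1
  refine Finset.prod_congr rfl fun v hv => ?_
  rw [Function.update_of_ne (Finset.ne_of_mem_erase hv)]

/-- The product operator `⨂_v B_v` as a linear function of its factor at `w`. -/
def tensorSlot (B : V → Matrix (Fin q) (Fin q) ℂ) (w : V) :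
    Matrix (Fin q) (Fin q) ℂ →ₗ[ℂ] Op V q where
  toFun A := tensor (Function.update B w A)
  map_add' A A' := by
    ext σ τ
    simp only [Matrix.add_apply, tensor_update_apply, add_mul]
  map_smul' c A := by
    ext σ τ
    simp only [Matrix.smul_apply, tensor_update_apply, smul_eq_mul, mul_assoc, RingHom.id_apply]

/-- The operator acting as `A` at the site `w` and trivially elsewhere. -/
def siteOp (w : V) : Matrix (Fin q) (Fin q) ℂ →ₗ[ℂ] Op V q := tensorSlot 1 w

theorem siteOp_def (w : V) (A : Matrix (Fin q) (Fin q) ℂ) :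
    siteOp w A = tensor (Function.update (1 : V → Matrix (Fin q) (Fin q) ℂ) w A) := rfl

theorem siteOp_one (w : V) : siteOp w (1 : Matrix (Fin q) (Fin q) ℂ) = 1 := by
  rw [siteOp_def, ← Pi.one_apply (M := fun _ : V => Matrix (Fin q) (Fin q) ℂ) w,
    Function.update_eq_self, tensor_one]

theorem siteOp_mul_tensor (w : V) (A : Matrix (Fin q) (Fin q) ℂ)
    (B : V → Matrix (Fin q) (Fin q) ℂ) :
    siteOp w A * tensor B = tensor (Function.update B w (A * B w)) := by
  rw [siteOp_def, tensor_mul]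
  congr 1
  ext v : 1
  by_cases hv : v = w
  · subst hv; simp
  · simp [Function.update_of_ne hv]

theorem tensor_mul_siteOp (w : V) (A : Matrix (Fin q) (Fin q) ℂ)
    (B : V → Matrix (Fin q) (Fin q) ℂ) :
    tensor B * siteOp w A = tensor (Function.update B w (B w * A)) := by
  rw [siteOp_def, tensor_mul]
  congr 1
  ext v : 1
  by_cases hv : v = w
  · subst hv; simp
  · simp [Function.update_of_ne hv]

theorem siteOp_mul (w : V) (A B : Matrix (Fin q) (Fin q) ℂ) :
    siteOp w A * siteOp w B = siteOp w (A * B) := by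
  rw [siteOp_def w B, siteOp_mul_tensor, siteOp_def]
  simp

theorem siteOp_conjTranspose (w : V) (A : Matrix (Fin q) (Fin q) ℂ) :
    (siteOp w A)ᴴ = siteOp w Aᴴ := by
  rw [siteOp_def, tensor_conjTranspose, siteOp_def]
  congr 1
  ext v : 1
  by_cases hv : v = w
  · subst hv; simp
  · simp [Function.update_of_ne hv]

theorem siteOp_commute {v w : V} (hvw : v ≠ w) (A B : Matrix (Fin q) (Fin q) ℂ) :
    Commute (siteOp v A) (siteOp w B) := by
  rw [Commute, SemiconjBy, siteOp_def w B, siteOp_mul_tensor, tensor_mul_siteOp]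
  simp [Function.update_of_ne hvw]

/-- `X` acts trivially at the site `w`, expressed by commutation with the operators at `w`. -/
def TrivialAt (w : V) (X : Op V q) : Prop :=
  ∀ A : Matrix (Fin q) (Fin q) ℂ, Commute X (siteOp w A)

theorem commute_tensor {X : Op V q} {B : V → Matrix (Fin q) (Fin q) ℂ}
    (h : ∀ v, Commute X (siteOp v (B v))) : Commute X (tensor B) := by
  have key : ∀ S : Finset V, Commute X (tensor fun v => if v ∈ S then B v else 1) := by
    intro S
    induction S using Finset.induction_on with
    | empty =>
      have h1 : (tensor fun v : V => if v ∈ (∅ : Finset V) then B v else 1) = 1 := by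
        simp only [Finset.notMem_empty, if_false]
        exact tensor_one
      rw [h1]; exact Commute.one_right X
    | insert w S hw ih =>
      have h1 : (tensor fun v => if v ∈ insert w S then B v else 1) =
          siteOp w (B w) * tensor fun v => if v ∈ S then B v else 1 := by
        rw [siteOp_mul_tensor]
        congr 1
        ext v : 1
        by_cases hv : v = w
        · subst hv; simp [hw]
        · simp [hv]
      rw [h1]
      exact (h w).mul_right ih
  simpa using key Finset.univ

/-- An operator supported on `S` is a linear combination of tensor products of matrix units at the
sites of `S`, so it commutes with whatever commutes with the operators at these sites. -/
theorem ActsOn.commute {K Y : Op V q} {S : Set V} (hK : ActsOn K S)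
    (hY : ∀ w ∈ S, TrivialAt w Y) : Commute K Y := by
  classical
  obtain ⟨h, hh⟩ := hK
  let B (α β : S → Fin q) (v : V) : Matrix (Fin q) (Fin q) ℂ :=
    if hv : v ∈ S then Matrix.single (α ⟨v, hv⟩) (β ⟨v, hv⟩) 1 else 1
  have hB : ∀ α β : S → Fin q, ∀ σ τ : V → Fin q, tensor (B α β) σ τ =
      if ((∀ w, w ∉ S → σ w = τ w) ∧ α = (fun w : S => σ w) ∧ β = fun w : S => τ w)
        then 1 else 0 := by
    intro α β σ τ
    rw [tensor_apply]
    split_ifs with hc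
    · obtain ⟨h1, rfl, rfl⟩ := hc
      refine Finset.prod_eq_one fun v _ => ?_
      by_cases hv : v ∈ S
      · simp [B, hv]
      · simp [B, hv, h1 v hv]
    · by_contra h0
      have h2 := fun v => (Finset.prod_ne_zero_iff.1 h0) v (Finset.mem_univ v)
      refine hc ⟨fun w hw => ?_, ?_, ?_⟩
      · have := h2 w
        simp only [B, hw, dite_false] at this
        by_contra hne
        exact this (Matrix.one_apply_ne hne)
      all_goals
        ext ⟨w, hw⟩ : 1
        have := h2 w
        simp only [B, hw, dite_true, Matrix.single_apply] at this
        by_contra hne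
        apply this
        rw [if_neg]
        tauto
  have hsum : K = ∑ α : S → Fin q, ∑ β : S → Fin q, h α β • tensor (B α β) := by
    ext σ τ
    simp only [Matrix.sum_apply, Matrix.smul_apply, hB, smul_eq_mul]
    by_cases hc : ∀ w, w ∉ S → σ w = τ w
    · rw [(hh σ τ).1 hc, Finset.sum_eq_single (fun w : S => σ w),
        Finset.sum_eq_single (fun w : S => τ w)]
      · rw [if_pos ⟨hc, rfl, rfl⟩, mul_one]
      · intro β _ hβ
        rw [if_neg (fun hx => hβ hx.2.2), mul_zero]
      · simp
      · intro α _ hα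
        refine Finset.sum_eq_zero fun β _ => ?_
        rw [if_neg (fun hx => hα hx.2.1), mul_zero]
      · simp
    · rw [(hh σ τ).2 hc]
      symm
      refine Finset.sum_eq_zero fun α _ => Finset.sum_eq_zero fun β _ => ?_
      rw [if_neg (fun hx => hc hx.1), mul_zero]
  rw [hsum]
  refine Commute.sum_left _ _ _ fun α _ => Commute.sum_left _ _ _ fun β _ =>
    Commute.smul_left (commute_tensor fun v => ?_).symm _
  by_cases hv : v ∈ S
  · exact hY v hv _
  · simp only [B, hv, dite_false, siteOp_one]
    exact Commute.one_right Y

theorem ActsOn.trivialAt {K : Op V q} {S : Set V} (hK : ActsOn K S) {w : V} (hw : w ∉ S) :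
    TrivialAt w K := fun _ =>
  hK.commute fun v hv _ => siteOp_commute (fun h : w = v => hw (h ▸ hv)) _ _

theorem ActsOn.commute_of_disjoint {K K' : Op V q} {S S' : Set V} (hK : ActsOn K S)
    (hK' : ActsOn K' S') (h : Disjoint S S') : Commute K K' :=
  hK.commute fun _ hw => hK'.trivialAt (Set.disjoint_left.1 h hw)

theorem siteOp_actsOn {S : Set V} {w : V} (hw : w ∈ S) (A : Matrix (Fin q) (Fin q) ℂ) :
    ActsOn (siteOp w A) S := by
  classical
  refine ⟨fun α β => if ∀ v : S, (v : V) ≠ w → α v = β v then A (α ⟨w, hw⟩) (β ⟨w, hw⟩) else 0,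
    fun σ τ => ?_⟩
  rw [siteOp_def, tensor_update_apply]
  beta_reduce
  constructor
  · intro hc
    split_ifs with hs
    · rw [Finset.prod_eq_one, mul_one]
      intro v hv
      have hvw := Finset.ne_of_mem_erase hv
      have : σ v = τ v := by
        by_cases hvS : v ∈ S
        · exact hs ⟨v, hvS⟩ hvw
        · exact hc v hvS
      rw [this]
      exact Matrix.one_apply_eq _
    · push Not at hs
      obtain ⟨v, hvw, hne⟩ := hs
      rw [Finset.prod_eq_zero (Finset.mem_erase.2 ⟨hvw, Finset.mem_univ _⟩), mul_zero]
      exact Matrix.one_apply_ne hne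
  · intro hc
    push Not at hc
    obtain ⟨v, hv, hne⟩ := hc
    rw [Finset.prod_eq_zero (Finset.mem_erase.2 ⟨fun h : v = w => hv (h ▸ hw),
      Finset.mem_univ v⟩), mul_zero]
    exact Matrix.one_apply_ne hne

omit [Fintype V] [DecidableEq V] in
theorem actsOn_univ (X : Op V q) : ActsOn X Set.univ := by
  refine ⟨Matrix.of fun α β => X (fun v => α ⟨v, trivial⟩) (fun v => β ⟨v, trivial⟩), ?_⟩
  intro σ τ
  exact ⟨fun _ => rfl, fun hc => absurd (fun w hw => absurd (Set.mem_univ w) hw) hc⟩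

theorem exists_eq_smul_one {X : Op V q} (h : ∀ w, TrivialAt w X) :
    ∃ c : ℂ, X = c • (1 : Op V q) := by
  have h1 : X ∈ Set.range (Matrix.scalar (V → Fin q)) := by
    rw [Matrix.mem_range_scalar_iff_commute_single]
    intro i j _
    exact (actsOn_univ _).commute fun w _ => h w
  obtain ⟨c, rfl⟩ := h1
  exact ⟨c, by rw [Matrix.smul_one_eq_diagonal]; rfl⟩

end TensorProducts

/-! ### Averaging a site -/

section ConditionalExpectation

variable {V : Type*} [Fintype V] [DecidableEq V] {q : ℕ}

/-- The matrix unit `|i⟩⟨j|` at the site `w`. -/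
def siteUnit (w : V) (i j : Fin q) : Op V q := siteOp w (Matrix.single i j 1)

theorem siteUnit_mul (w : V) (i j k l : Fin q) :
    siteUnit w i j * siteUnit w k l = if j = k then siteUnit w i l else 0 := by
  rw [siteUnit, siteUnit, siteOp_mul]
  split_ifs with h
  · subst h; simp [siteUnit]
  · simp [h]

theorem siteUnit_mul_mul (w : V) (i j k l : Fin q) (X : Op V q) :
    siteUnit w i j * (siteUnit w k l * X) = if j = k then siteUnit w i l * X else 0 := by
  rw [← mul_assoc, siteUnit_mul, ite_mul, zero_mul]

theorem TrivialAt.siteUnit_mul {w : V} {X : Op V q} (hX : TrivialAt w X) (i j : Fin q) :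
    siteUnit w i j * X = X * siteUnit w i j := (hX _).eq.symm

theorem siteOp_eq_sum (w : V) (A : Matrix (Fin q) (Fin q) ℂ) :
    siteOp w A = ∑ i, ∑ j, A i j • siteUnit w i j := by
  conv_lhs => rw [Matrix.matrix_eq_sum_single A]
  simp only [map_sum, siteUnit, ← map_smul, Matrix.smul_single, smul_eq_mul, mul_one]

theorem sum_siteUnit (w : V) : ∑ i : Fin q, siteUnit w i i = (1 : Op V q) := by
  rw [← siteOp_one w, siteOp_eq_sum]
  simp [Matrix.one_apply]

theorem trivialAt_of_siteUnit {w : V} {X : Op V q} (h : ∀ i j, Commute X (siteUnit w i j)) :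
    TrivialAt w X := fun A => by
  rw [siteOp_eq_sum]
  exact Commute.sum_right _ _ _ fun i _ => Commute.sum_right _ _ _ fun j _ =>
    (h i j).smul_right _

/-- The map `A ↦ tr_w[(r ⊗ 𝕀) A] ⊗ 𝕀_w`, which replaces the site `w` by its average in the
matrix `r`, written by means of the matrix units at `w`. -/
def condExp (r : Matrix (Fin q) (Fin q) ℂ) (w : V) : Op V q →ₗ[ℂ] Op V q :=
  ∑ a, ∑ b, ∑ c, r b a • (LinearMap.mulLeft ℂ (siteUnit w c a) ∘ₗ
    LinearMap.mulRight ℂ (siteUnit w b c))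

theorem condExp_apply (r : Matrix (Fin q) (Fin q) ℂ) (w : V) (A : Op V q) :
    condExp r w A = ∑ a, ∑ b, ∑ c, r b a • (siteUnit w c a * A * siteUnit w b c) := by
  simp [condExp, LinearMap.sum_apply, mul_assoc]

theorem condExp_trivialAt (r : Matrix (Fin q) (Fin q) ℂ) (w : V) (A : Op V q) :
    TrivialAt w (condExp r w A) := by
  refine trivialAt_of_siteUnit fun i j => ?_
  rw [Commute, SemiconjBy, condExp_apply]
  simp only [Finset.sum_mul, Finset.mul_sum, smul_mul_assoc, mul_smul_comm]
  simp only [mul_assoc, siteUnit_mul, siteUnit_mul_mul, mul_ite, mul_zero, smul_ite, smul_zero,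
    Finset.sum_ite_eq, Finset.sum_ite_eq', Finset.mem_univ, if_true]

theorem condExp_mul_left (r : Matrix (Fin q) (Fin q) ℂ) {w : V} {X : Op V q}
    (hX : TrivialAt w X) (A : Op V q) : condExp r w (X * A) = X * condExp r w A := by
  simp only [condExp_apply, Finset.mul_sum, mul_smul_comm]
  refine Finset.sum_congr rfl fun a _ => Finset.sum_congr rfl fun b _ =>
    Finset.sum_congr rfl fun c _ => ?_
  rw [← mul_assoc, hX.siteUnit_mul]
  simp only [mul_assoc]

theorem condExp_mul_right (r : Matrix (Fin q) (Fin q) ℂ) {w : V} {X : Op V q}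
    (hX : TrivialAt w X) (A : Op V q) : condExp r w (A * X) = condExp r w A * X := by
  simp only [condExp_apply, Finset.sum_mul, smul_mul_assoc, mul_assoc, hX.siteUnit_mul]

theorem condExp_one {r : Matrix (Fin q) (Fin q) ℂ} (hr : r.trace = 1) (w : V) :
    condExp r w (1 : Op V q) = 1 := by
  rw [condExp_apply]
  simp only [mul_one, siteUnit_mul, smul_ite, smul_zero]
  simp only [← Finset.smul_sum, Finset.sum_ite_irrel, Finset.sum_const_zero, sum_siteUnit,
    Finset.sum_ite_eq, Finset.mem_univ, if_true]
  rw [← Finset.sum_smul]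
  have : ∑ a, r a a = 1 := hr
  rw [this, one_smul]

theorem condExp_of_trivialAt {r : Matrix (Fin q) (Fin q) ℂ} (hr : r.trace = 1) {w : V}
    {X : Op V q} (hX : TrivialAt w X) : condExp r w X = X := by
  simpa [condExp_one hr] using condExp_mul_left r hX 1

theorem condExp_conjTranspose {r : Matrix (Fin q) (Fin q) ℂ} (hr : r.IsHermitian) (w : V)
    (A : Op V q) : (condExp r w A)ᴴ = condExp r w Aᴴ := by
  have hE : ∀ i j, (siteUnit w i j : Op V q)ᴴ = siteUnit w j i := fun i j => by
    rw [siteUnit, siteOp_conjTranspose, siteUnit]; simp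
  simp only [condExp_apply, Matrix.conjTranspose_sum, Matrix.conjTranspose_smul,
    Matrix.conjTranspose_mul, hE, ← mul_assoc]
  rw [Finset.sum_comm]
  refine Finset.sum_congr rfl fun a _ => Finset.sum_congr rfl fun b _ =>
    Finset.sum_congr rfl fun c _ => ?_
  rw [hr.apply]

theorem siteUnit_commute {v w : V} (hvw : v ≠ w) (i j k l : Fin q) :
    Commute (siteUnit v i j) (siteUnit w k l) := siteOp_commute hvw _ _

theorem siteUnit_trivialAt {v w : V} (hvw : v ≠ w) (i j : Fin q) :
    TrivialAt v (siteUnit w i j : Op V q) := fun _ => siteOp_commute hvw.symm _ _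

theorem TrivialAt.condExp {v : V} {X : Op V q} (hX : TrivialAt v X)
    (r : Matrix (Fin q) (Fin q) ℂ) (w : V) : TrivialAt v (condExp r w X) := by
  by_cases hvw : v = w
  · subst hvw; exact condExp_trivialAt r v X
  · refine trivialAt_of_siteUnit fun i j => ?_
    rw [condExp_apply]
    refine Commute.sum_left _ _ _ fun a _ => Commute.sum_left _ _ _ fun b _ =>
      Commute.sum_left _ _ _ fun c _ => Commute.smul_left ?_ _
    exact ((siteUnit_commute (Ne.symm hvw) _ _ _ _).mul_left (hX _)).mul_left
      (siteUnit_commute (Ne.symm hvw) _ _ _ _)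

theorem condExp_commute (r : V → Matrix (Fin q) (Fin q) ℂ) (v w : V) (A : Op V q) :
    condExp (r v) v (condExp (r w) w A) = condExp (r w) w (condExp (r v) v A) := by
  by_cases hvw : v = w
  · subst hvw; rfl
  · rw [condExp_apply (r w), condExp_apply (r w)]
    simp only [map_sum, map_smul]
    refine Finset.sum_congr rfl fun a _ => Finset.sum_congr rfl fun b _ =>
      Finset.sum_congr rfl fun c _ => ?_
    rw [condExp_mul_right _ (siteUnit_trivialAt hvw _ _),
      condExp_mul_left _ (siteUnit_trivialAt hvw _ _)]

/-- A product operator is invariant under the dual of the averaging over its own factor. -/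
theorem trace_tensor_mul_condExp {r : V → Matrix (Fin q) (Fin q) ℂ} {w : V}
    (hr : (r w).trace = 1) (A : Op V q) :
    (tensor r * condExp (r w) w A).trace = (tensor r * A).trace := by
  have h1 : ∀ a b c, siteUnit w b c * tensor r * siteUnit w c a =
      tensorSlot r w ((r w) c c • Matrix.single b a 1) := by
    intro a b c
    rw [siteUnit, siteUnit, siteOp_mul_tensor, tensor_mul_siteOp]
    simp only [Function.update_self, Function.update_idem]
    rw [tensorSlot]
    simp only [LinearMap.coe_mk, AddHom.coe_mk]
    congr 2
    ext i j
    simp [Matrix.single_mul_mul_single, Matrix.single_apply]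
  have h2 : ∑ a, ∑ b, ∑ c, r w b a • (siteUnit w b c * tensor r * siteUnit w c a) = tensor r := by
    simp only [h1, ← map_smul, ← map_sum, smul_smul]
    have h3 : ∑ a, ∑ b, ∑ c, (r w b a * r w c c) • Matrix.single b a (1 : ℂ) = r w := by
      simp only [← Finset.sum_smul, ← Finset.mul_sum]
      have : ∑ c, r w c c = 1 := hr
      rw [this, Finset.sum_comm]
      conv_rhs => rw [Matrix.matrix_eq_sum_single (r w)]
      simp
    rw [h3, tensorSlot]
    simp
  conv_rhs => rw [← h2]
  simp only [condExp_apply, Finset.mul_sum, Finset.sum_mul, Matrix.trace_sum, mul_smul_comm,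
    smul_mul_assoc, Matrix.trace_smul]
  refine Finset.sum_congr rfl fun a _ => Finset.sum_congr rfl fun b _ =>
    Finset.sum_congr rfl fun c _ => ?_
  rw [← mul_assoc, Matrix.trace_mul_comm]
  simp only [mul_assoc]

/-- The composition of the averages over a list of sites. -/
def condExpList (r : V → Matrix (Fin q) (Fin q) ℂ) : List V → Op V q →ₗ[ℂ] Op V q
  | [] => LinearMap.id
  | w :: l => condExpList r l ∘ₗ condExp (r w) w

theorem condExpList_commute (r : V → Matrix (Fin q) (Fin q) ℂ) (l : List V) (w : V)
    (A : Op V q) :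
    condExpList r l (condExp (r w) w A) = condExp (r w) w (condExpList r l A) := by
  induction l generalizing A with
  | nil => rfl
  | cons v l ih =>
    simp only [condExpList, LinearMap.comp_apply]
    rw [condExp_commute, ih]

theorem condExpList_trivialAt (r : V → Matrix (Fin q) (Fin q) ℂ) {l : List V} {w : V}
    (hw : w ∈ l) (A : Op V q) : TrivialAt w (condExpList r l A) := by
  induction l generalizing A with
  | nil => simp at hw
  | cons v l ih =>
    simp only [condExpList, LinearMap.comp_apply]
    rcases List.mem_cons.1 hw with rfl | hw
    · rw [condExpList_commute]; exact condExp_trivialAt _ _ _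
    · exact ih hw _

theorem trace_tensor_mul_condExpList {r : V → Matrix (Fin q) (Fin q) ℂ}
    (hr : ∀ w, (r w).trace = 1) (l : List V) (A : Op V q) :
    (tensor r * condExpList r l A).trace = (tensor r * A).trace := by
  induction l generalizing A with
  | nil => rfl
  | cons v l ih =>
    simp only [condExpList, LinearMap.comp_apply]
    rw [ih, trace_tensor_mul_condExp (hr v)]

/-- Averaging over all sites gives a scalar, because only scalars commute with all operators. -/
theorem exists_condExpList_eq_smul_one (r : V → Matrix (Fin q) (Fin q) ℂ) (A : Op V q) :
    ∃ c : ℂ, condExpList r Finset.univ.toList A = c • (1 : Op V q) :=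
  exists_eq_smul_one fun w => condExpList_trivialAt r (by simp) A

end ConditionalExpectation

/-! ### The variance in a product state -/

section Variance

open scoped Matrix.Norms.L2Operator

variable {V : Type*} [Fintype V] [DecidableEq V] {q : ℕ}

theorem opNorm_eq_norm (X : Op V q) : opNorm X = ‖X‖ := (Matrix.cstar_norm_def X).symm

theorem trace_tensor (B : V → Matrix (Fin q) (Fin q) ℂ) :
    (tensor B).trace = ∏ v, (B v).trace := by
  simp only [Matrix.trace, Matrix.diag_apply, tensor_apply, Finset.prod_univ_sum,
    Fintype.piFinset_univ]

open scoped MatrixOrder in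
theorem exists_eq_conjTranspose_mul_self {ι : Type*} [Fintype ι] {A : Matrix ι ι ℂ}
    (hA : A.PosSemidef) : ∃ B : Matrix ι ι ℂ, A = Bᴴ * B := by
  classical
  exact (CStarAlgebra.nonneg_iff_eq_star_mul_self).1 hA.nonneg

theorem tensor_isState {r : V → Matrix (Fin q) (Fin q) ℂ} (hr : ∀ v, IsState (r v)) :
    IsState (tensor r) := by
  choose B hB using fun v => exists_eq_conjTranspose_mul_self (hr v).1
  refine ⟨?_, by rw [trace_tensor]; exact Finset.prod_eq_one fun v _ => (hr v).2⟩
  have : tensor r = (tensor B)ᴴ * tensor B := by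
    rw [tensor_conjTranspose, tensor_mul]
    congr 1
    ext v : 1
    exact hB v
  rw [this]
  exact Matrix.posSemidef_conjTranspose_mul_self _

/-- The squared seminorm `tr[ρ |A|²]` of the GNS construction. -/
def gnsSq (ρ A : Op V q) : ℝ := (ρ * (Aᴴ * A)).trace.re

theorem trace_mul_nonneg {ρ X : Op V q} (hρ : ρ.PosSemidef) (hX : X.PosSemidef) :
    0 ≤ (ρ * X).trace.re := by
  obtain ⟨B, rfl⟩ := exists_eq_conjTranspose_mul_self hρ
  rw [mul_assoc, Matrix.trace_mul_comm]
  exact (Complex.le_def.1 (hX.mul_mul_conjTranspose_same B).trace_nonneg).1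

theorem gnsSq_nonneg {ρ : Op V q} (hρ : ρ.PosSemidef) (A : Op V q) : 0 ≤ gnsSq ρ A :=
  trace_mul_nonneg hρ (Matrix.posSemidef_conjTranspose_mul_self A)

open scoped MatrixOrder in
theorem gnsSq_le_norm_sq {ρ : Op V q} (hρ : IsState ρ) (A : Op V q) : gnsSq ρ A ≤ ‖A‖ ^ 2 := by
  have h1 : (algebraMap ℝ (Op V q) (‖A‖ ^ 2) - Aᴴ * A).PosSemidef :=
    Matrix.le_iff.1 (CStarAlgebra.star_mul_le_algebraMap_norm_sq (a := A))
  have h2 := trace_mul_nonneg hρ.1 h1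
  rw [mul_sub, Matrix.trace_sub, Complex.sub_re, Algebra.algebraMap_eq_smul_one, mul_smul_comm,
    mul_one, Matrix.trace_smul, hρ.2] at h2
  simp only [Complex.real_smul, mul_one, Complex.ofReal_re] at h2
  exact sub_nonneg.1 h2

theorem gnsSq_add_of_orthogonal {ρ : Op V q} (hρ : ρ.IsHermitian) {A B : Op V q}
    (h : (ρ * (Aᴴ * B)).trace = 0) : gnsSq ρ (A + B) = gnsSq ρ A + gnsSq ρ B := by
  have h' : (ρ * (Bᴴ * A)).trace = 0 := by
    rw [← star_eq_zero, ← Matrix.trace_conjTranspose]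
    simpa only [Matrix.conjTranspose_mul, Matrix.conjTranspose_conjTranspose, hρ.eq,
      Matrix.trace_mul_comm _ ρ] using h
  simp only [gnsSq, Matrix.conjTranspose_add, add_mul, mul_add, Matrix.trace_add, h, h',
    Complex.add_re, Complex.zero_re]
  ring

/-- In the GNS inner product of a product state, averaging a site in the state of that site is the
orthogonal projection onto the operators which are trivial at that site. -/
theorem trace_sub_condExp_mul {r : V → Matrix (Fin q) (Fin q) ℂ} (hr : ∀ v, IsState (r v))
    (w : V) (A : Op V q) {B : Op V q} (hB : TrivialAt w B) :
    (tensor r * ((A - condExp (r w) w A)ᴴ * B)).trace = 0 := by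
  rw [← trace_tensor_mul_condExp (hr w).2, condExp_mul_right _ hB, Matrix.conjTranspose_sub,
    condExp_conjTranspose (hr w).1.isHermitian, map_sub,
    condExp_of_trivialAt (hr w).2 (condExp_trivialAt _ _ _)]
  simp

theorem gnsSq_sub_add_of_trivialAt {r : V → Matrix (Fin q) (Fin q) ℂ}
    (hr : ∀ v, IsState (r v)) (w : V) (A : Op V q) {B : Op V q} (hB : TrivialAt w B) :
    gnsSq (tensor r) (A - condExp (r w) w A + B) =
      gnsSq (tensor r) (A - condExp (r w) w A) + gnsSq (tensor r) B :=
  gnsSq_add_of_orthogonal (tensor_isState hr).1.isHermitian (trace_sub_condExp_mul hr w A hB)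

theorem gnsSq_eq_add_condExp {r : V → Matrix (Fin q) (Fin q) ℂ} (hr : ∀ v, IsState (r v))
    (w : V) (A : Op V q) :
    gnsSq (tensor r) A = gnsSq (tensor r) (A - condExp (r w) w A) +
      gnsSq (tensor r) (condExp (r w) w A) := by
  rw [← gnsSq_sub_add_of_trivialAt hr w A (condExp_trivialAt _ _ _), sub_add_cancel]

/-- The Efron–Stein inequality: averaging the sites successively costs at most the sum of the
costs of averaging each site of the initial operator. -/
theorem gnsSq_sub_condExpList_le {r : V → Matrix (Fin q) (Fin q) ℂ}
    (hr : ∀ v, IsState (r v)) (l : List V) (A : Op V q) :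
    gnsSq (tensor r) (A - condExpList r l A) ≤
      (l.map fun w => gnsSq (tensor r) (A - condExp (r w) w A)).sum := by
  have hρ := (tensor_isState hr).1
  induction l with
  | nil => simp [condExpList, gnsSq]
  | cons w l ih =>
    have h1 : A - condExpList r (w :: l) A = A - condExp (r w) w A +
        condExp (r w) w (A - condExpList r l A) := by
      simp only [condExpList, LinearMap.comp_apply, map_sub, condExpList_commute]
      abel
    rw [h1, gnsSq_sub_add_of_trivialAt hr w A (condExp_trivialAt _ _ _), List.map_cons,
      List.sum_cons]
    refine add_le_add_right (le_trans ?_ ih) _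
    have h2 := gnsSq_eq_add_condExp hr w (A - condExpList r l A)
    have h3 := gnsSq_nonneg hρ (A - condExpList r l A -
      condExp (r w) w (A - condExpList r l A))
    linarith

/-- The variance in a product state is at most the sum over the sites of the squared distances
to operators which are trivial at the site. -/
theorem variance_tensor_le {r : V → Matrix (Fin q) (Fin q) ℂ} (hr : ∀ v, IsState (r v))
    (O : Op V q) {X : V → Op V q} (hX : ∀ w, TrivialAt w (X w)) :
    variance (tensor r) O ≤ ∑ w, ‖O - X w‖ ^ 2 := by
  have hρ := tensor_isState hr
  obtain ⟨c, hc⟩ := exists_condExpList_eq_smul_one r O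
  have hc' : (tensor r * O).trace = c := by
    rw [← trace_tensor_mul_condExpList (fun w => (hr w).2) Finset.univ.toList, hc,
      mul_smul_comm, mul_one, Matrix.trace_smul, hρ.2, smul_eq_mul, mul_one]
  have h1 : variance (tensor r) O =
      gnsSq (tensor r) (O - condExpList r Finset.univ.toList O) := by
    rw [variance, gnsSq, hc', hc]
  rw [h1]
  refine (gnsSq_sub_condExpList_le hr _ O).trans ?_
  rw [Finset.sum_map_toList]
  refine Finset.sum_le_sum fun w _ => ?_
  refine le_trans ?_ (gnsSq_le_norm_sq hρ (O - X w))
  have h2 := gnsSq_eq_add_condExp hr w (O - X w)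
  rw [map_sub, condExp_of_trivialAt (hr w).2 (hX w), sub_sub_sub_cancel_right] at h2
  have h3 := gnsSq_nonneg hρ.1 (condExp (r w) w O - X w)
  linarith

end Variance

/-! ### Twirling a site -/

section Twirl

open scoped Matrix.Norms.L2Operator

variable {V : Type*} [Fintype V] [DecidableEq V] {q : ℕ} [NeZero q]

/-- The cyclic shift by `c`, followed by the signs `ε`. -/
def signShift (p : (Fin q → ℤˣ) × Fin q) : Matrix (Fin q) (Fin q) ℂ :=
  Matrix.of fun j k => if j = k + p.2 then ((p.1 j : ℤ) : ℂ) else 0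

theorem signShift_mul_conjTranspose (p : (Fin q → ℤˣ) × Fin q) :
    signShift p * (signShift p)ᴴ = 1 := by
  obtain ⟨ε, c⟩ := p
  ext j l
  simp only [Matrix.mul_apply, Matrix.conjTranspose_apply, signShift, Matrix.of_apply]
  rw [Finset.sum_eq_single (j - c)]
  · simp only [sub_add_cancel, if_true, Matrix.one_apply]
    by_cases h : l = j
    · subst h
      simp [← Int.cast_mul, ← Units.val_mul]
    · simp [h, Ne.symm h]
  · intro k _ hk
    rw [if_neg (fun h => hk (by rw [h, add_sub_cancel_right])), zero_mul]
  · simp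

omit [NeZero q] in
theorem sum_sign_mul_sign (j l : Fin q) :
    ∑ ε : Fin q → ℤˣ, ((ε j : ℤ) : ℂ) * ((ε l : ℤ) : ℂ) =
      if j = l then (Fintype.card (Fin q → ℤˣ) : ℂ) else 0 := by
  split_ifs with h
  · subst h
    simp [← Int.cast_mul, ← Units.val_mul]
  · -- flipping the sign at `j` changes the sign of the sum
    have h1 := Equiv.sum_comp (Equiv.mulLeft (Function.update (1 : Fin q → ℤˣ) j (-1)))
      fun ε : Fin q → ℤˣ => ((ε j : ℤ) : ℂ) * ((ε l : ℤ) : ℂ)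
    simp only [Equiv.coe_mulLeft, Pi.mul_apply, Function.update_self,
      Function.update_of_ne (Ne.symm h), Pi.one_apply, one_mul, neg_mul, Units.val_neg,
      Int.cast_neg, Finset.sum_neg_distrib] at h1
    exact neg_eq_self.1 h1

/-- The signed shifts form a unitary one-design. -/
theorem sum_signShift (j k l m : Fin q) :
    ∑ p, signShift p j k * star (signShift p l m) =
      if j = l ∧ k = m then (Fintype.card (Fin q → ℤˣ) : ℂ) else 0 := by
  rw [Fintype.sum_prod_type_right]
  have h1 : ∀ c : Fin q, ∑ ε : Fin q → ℤˣ, signShift (ε, c) j k * star (signShift (ε, c) l m) =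
      if c = j - k then (if j = l ∧ k = m then (Fintype.card (Fin q → ℤˣ) : ℂ) else 0)
        else 0 := by
    intro c
    simp only [signShift, Matrix.of_apply]
    by_cases hc : j = k + c
    · have hc' : c = j - k := by rw [hc, add_sub_cancel_left]
      rw [if_pos hc']
      simp only [if_pos hc]
      by_cases hl : l = m + c
      · have h2 := sum_sign_mul_sign j l
        have h3 : (j = l ∧ k = m) ↔ j = l := by
          refine ⟨fun h => h.1, fun h => ⟨h, ?_⟩⟩
          rw [hc, hl] at h
          exact add_right_cancel h
        simp only [if_pos hl, h3]
        rw [← h2]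
        simp
      · have h3 : ¬ (j = l ∧ k = m) := by
          rintro ⟨rfl, rfl⟩
          exact hl hc
        simp [hl, h3]
    · have hc' : ¬ c = j - k := fun h => hc (by rw [h, add_sub_cancel])
      simp [hc, hc']
  simp only [h1, Finset.sum_ite_eq', Finset.mem_univ, if_true]

/-- The average of the site `w` in the maximally mixed state, `A ↦ q⁻¹ tr_w[A] ⊗ 𝕀_w`. It is also an
average of unitary conjugations, by `twirl_eq_average`. -/
def twirl (w : V) : Op V q →ₗ[ℂ] Op V q := condExp ((q : ℂ)⁻¹ • 1) w

omit [NeZero q] in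
theorem twirl_def (w : V) (A : Op V q) : twirl w A = condExp ((q : ℂ)⁻¹ • 1) w A := rfl

theorem trace_inv_smul_one : ((q : ℂ)⁻¹ • (1 : Matrix (Fin q) (Fin q) ℂ)).trace = 1 := by
  rw [Matrix.trace_smul, Matrix.trace_one, Fintype.card_fin, smul_eq_mul,
    inv_mul_cancel₀ (Nat.cast_ne_zero.2 (NeZero.ne q))]

theorem twirl_eq_average (w : V) (A : Op V q) :
    twirl w A = (Fintype.card ((Fin q → ℤˣ) × Fin q) : ℂ)⁻¹ •
      ∑ p : (Fin q → ℤˣ) × Fin q,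
        siteOp w (signShift p) * A * (siteOp w (signShift p))ᴴ := by
  have h1 : ∀ p : (Fin q → ℤˣ) × Fin q,
      siteOp w (signShift p) * A * (siteOp w (signShift p))ᴴ =
      ∑ j, ∑ k, ∑ m, ∑ l, (signShift p j k * star (signShift p l m)) •
        (siteUnit w j k * A * siteUnit w m l) := by
    intro p
    rw [siteOp_conjTranspose, siteOp_eq_sum w (signShift p), siteOp_eq_sum w (signShift p)ᴴ,
      Finset.sum_mul, Finset.sum_mul]
    refine Finset.sum_congr rfl fun j _ => ?_
    rw [Finset.sum_mul, Finset.sum_mul]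
    refine Finset.sum_congr rfl fun k _ => ?_
    rw [Finset.mul_sum]
    refine Finset.sum_congr rfl fun m _ => ?_
    rw [Finset.mul_sum]
    refine Finset.sum_congr rfl fun l _ => ?_
    rw [smul_mul_assoc, smul_mul_assoc, mul_smul_comm, smul_smul, Matrix.conjTranspose_apply]
  have h2 : ∑ p : (Fin q → ℤˣ) × Fin q,
      siteOp w (signShift p) * A * (siteOp w (signShift p))ᴴ =
      ∑ j, ∑ k, (Fintype.card (Fin q → ℤˣ) : ℂ) • (siteUnit w j k * A * siteUnit w k j) := by
    simp only [h1]
    rw [Finset.sum_comm]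
    refine Finset.sum_congr rfl fun j _ => ?_
    rw [Finset.sum_comm]
    refine Finset.sum_congr rfl fun k _ => ?_
    rw [Finset.sum_comm, Finset.sum_eq_single k]
    · rw [Finset.sum_comm, Finset.sum_eq_single j]
      · rw [← Finset.sum_smul, sum_signShift, if_pos ⟨rfl, rfl⟩]
      · intro l _ hl
        rw [← Finset.sum_smul, sum_signShift, if_neg (fun h => hl h.1.symm), zero_smul]
      · simp
    · intro m _ hm
      rw [Finset.sum_comm]
      refine Finset.sum_eq_zero fun l _ => ?_
      rw [← Finset.sum_smul, sum_signShift, if_neg (fun h => hm h.2.symm), zero_smul]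
    · simp
  have hN : (Fintype.card (Fin q → ℤˣ) : ℂ) ≠ 0 := Nat.cast_ne_zero.2 Fintype.card_ne_zero
  have h3 : twirl w A = (q : ℂ)⁻¹ • ∑ a, ∑ c, siteUnit w c a * A * siteUnit w a c := by
    rw [twirl_def, condExp_apply]
    simp only [Matrix.smul_apply, Matrix.one_apply, smul_eq_mul, mul_ite, mul_one, mul_zero,
      ite_smul, zero_smul, Finset.sum_ite_irrel, Finset.sum_const_zero, Finset.sum_ite_eq',
      Finset.mem_univ, if_true, Finset.smul_sum]
  rw [h3, h2, Fintype.card_prod, Fintype.card_fin, Finset.sum_comm]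
  simp only [← Finset.smul_sum, smul_smul]
  congr 1
  push_cast
  field_simp

theorem siteOp_signShift_mem_unitary (w : V) (p : (Fin q → ℤˣ) × Fin q) :
    (siteOp w (signShift p) : Op V q) ∈ unitary (Op V q) := by
  have h1 := signShift_mul_conjTranspose p
  refine ⟨?_, ?_⟩
  · rw [Matrix.star_eq_conjTranspose, siteOp_conjTranspose, siteOp_mul, mul_eq_one_comm.1 h1,
      siteOp_one]
  · rw [Matrix.star_eq_conjTranspose, siteOp_conjTranspose, siteOp_mul, h1, siteOp_one]

theorem norm_inv_card_smul_sum_le {ι E : Type*} [Fintype ι] [Nonempty ι] [SeminormedAddCommGroup E]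
    [NormedSpace ℂ E] {f : ι → E} {c : ℝ} (h : ∀ i, ‖f i‖ ≤ c) :
    ‖(Fintype.card ι : ℂ)⁻¹ • ∑ i, f i‖ ≤ c := by
  have hpos : (0 : ℝ) < Fintype.card ι := Nat.cast_pos.2 Fintype.card_pos
  rw [norm_smul, norm_inv, Complex.norm_natCast, inv_mul_le_iff₀ hpos]
  calc ‖∑ i, f i‖ ≤ ∑ i : ι, c := norm_sum_le_of_le _ fun i _ => h i
    _ = Fintype.card ι * c := by simp

theorem norm_twirl_le (w : V) (A : Op V q) : ‖twirl w A‖ ≤ ‖A‖ := by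
  rw [twirl_eq_average]
  refine norm_inv_card_smul_sum_le fun p => ?_
  have hU := siteOp_signShift_mem_unitary w p
  rw [← Matrix.star_eq_conjTranspose, CStarRing.norm_mul_mem_unitary _ (Unitary.star_mem hU),
    CStarRing.norm_mem_unitary_mul _ hU]

theorem norm_sub_twirl_le_of_commutator {w : V} {A : Op V q} {c : ℝ}
    (h : ∀ p, ‖siteOp w (signShift p) * A - A * siteOp w (signShift p)‖ ≤ c) :
    ‖A - twirl w A‖ ≤ c := by
  have h1 : A - twirl w A = (Fintype.card ((Fin q → ℤˣ) × Fin q) : ℂ)⁻¹ •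
      ∑ p : (Fin q → ℤˣ) × Fin q,
        (A - siteOp w (signShift p) * A * (siteOp w (signShift p))ᴴ) := by
    rw [twirl_eq_average, Finset.sum_sub_distrib, smul_sub, Finset.sum_const, Finset.card_univ,
      ← Nat.cast_smul_eq_nsmul ℂ, smul_smul,
      inv_mul_cancel₀ (Nat.cast_ne_zero.2 Fintype.card_ne_zero), one_smul]
  rw [h1]
  refine norm_inv_card_smul_sum_le fun p => ?_
  have hU := siteOp_signShift_mem_unitary w p
  refine le_trans (le_of_eq ?_) (h p)
  rw [← CStarRing.norm_mul_mem_unitary (A - _) hU, sub_mul, mul_assoc _ (siteOp w _)ᴴ,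
    ← Matrix.star_eq_conjTranspose, (Unitary.mem_iff.1 hU).1, mul_one, norm_sub_rev]

omit [NeZero q] in
theorem twirl_trivialAt (w : V) (A : Op V q) : TrivialAt w (twirl w A) :=
  condExp_trivialAt _ _ _

theorem twirl_of_trivialAt {w : V} {X : Op V q} (hX : TrivialAt w X) : twirl w X = X :=
  condExp_of_trivialAt trace_inv_smul_one hX

theorem norm_sub_twirl_le {w : V} (A : Op V q) {X : Op V q} (hX : TrivialAt w X) :
    ‖A - twirl w A‖ ≤ 2 * ‖A - X‖ := by
  have h1 : A - twirl w A = (A - X) - twirl w (A - X) := by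
    rw [map_sub, twirl_of_trivialAt hX]; abel
  rw [h1, two_mul]
  exact (norm_sub_le _ _).trans (add_le_add_right (norm_twirl_le _ _) _)

theorem norm_sub_condExpList_twirl_le (l : List V) (A : Op V q) :
    ‖A - condExpList (fun _ => (q : ℂ)⁻¹ • 1) l A‖ ≤
      (l.map fun w => ‖A - twirl w A‖).sum := by
  induction l with
  | nil => simp [condExpList]
  | cons w l ih =>
    have h1 : A - condExpList (fun _ => (q : ℂ)⁻¹ • 1) (w :: l) A = A - twirl w A +
        twirl w (A - condExpList (fun _ => (q : ℂ)⁻¹ • 1) l A) := by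
      simp only [condExpList, LinearMap.comp_apply, map_sub, twirl_def,
        condExpList_commute (fun _ => (q : ℂ)⁻¹ • 1)]
      abel
    rw [h1, List.map_cons, List.sum_cons]
    exact (norm_add_le _ _).trans (add_le_add_right ((norm_twirl_le _ _).trans ih) _)

end Twirl

/-! ### The Lipschitz constant -/

section Lipschitz

open scoped Matrix.Norms.L2Operator

variable {V : Type*} [Fintype V] [DecidableEq V] {q : ℕ}

theorem siteOscillation_nonneg (w : V) (O : Op V q) : 0 ≤ siteOscillation w O :=
  mul_nonneg zero_le_two (Real.iInf_nonneg fun _ => norm_nonneg _)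

theorem siteOscillation_le_lipschitzConst (w : V) (O : Op V q) :
    siteOscillation w O ≤ lipschitzConst O :=
  le_ciSup (f := fun w => siteOscillation w O) (Set.finite_range _).bddAbove w

theorem lipschitzConst_nonneg (O : Op V q) : 0 ≤ lipschitzConst O :=
  Real.iSup_nonneg fun w => siteOscillation_nonneg w O

omit [Fintype V] [DecidableEq V] in
theorem actsOn_zero (S : Set V) : ActsOn (0 : Op V q) S :=
  ⟨0, fun _ _ => ⟨fun _ => rfl, fun _ => rfl⟩⟩

theorem ActsOn.trivialAt_of_compl {w : V} {X : Op V q} (hX : ActsOn X {w}ᶜ) : TrivialAt w X :=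
  hX.trivialAt (by simp)

/-- A bound affine in the distance to the operators which are trivial at `w` may be evaluated at
the infimum of this distance. -/
theorem le_mul_lipschitzConst {w : V} {O : Op V q} {a c : ℝ}
    (h : ∀ X : Op V q, TrivialAt w X → a ≤ c + 2 * ‖O - X‖) : a ≤ c + lipschitzConst O := by
  have : Nonempty {X : Op V q // X.IsHermitian ∧ ActsOn X {w}ᶜ} :=
    ⟨⟨0, Matrix.isHermitian_zero, actsOn_zero _⟩⟩
  have h1 : (a - c) / 2 ≤
      ⨅ X : {X : Op V q // X.IsHermitian ∧ ActsOn X {w}ᶜ}, opNorm (O - X.1) := by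
    refine le_ciInf fun X => ?_
    have := h X.1 X.2.2.trivialAt_of_compl
    rw [opNorm_eq_norm]
    linarith
  have h2 := siteOscillation_le_lipschitzConst w O
  rw [siteOscillation] at h2
  linarith

variable [NeZero q]

theorem norm_sub_twirl_le_lipschitzConst (w : V) (O : Op V q) :
    ‖O - twirl w O‖ ≤ lipschitzConst O := by
  simpa using le_mul_lipschitzConst (c := 0) (w := w) fun X hX => by
    simpa using norm_sub_twirl_le O hX

theorem exists_norm_sub_smul_one_le (O : Op V q) :
    ∃ c : ℂ, ‖O - c • (1 : Op V q)‖ ≤ Fintype.card V * lipschitzConst O := by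
  obtain ⟨c, hc⟩ := exists_condExpList_eq_smul_one (fun _ : V => (q : ℂ)⁻¹ • 1) O
  refine ⟨c, ?_⟩
  rw [← hc]
  refine (norm_sub_condExpList_twirl_le _ O).trans ?_
  rw [Finset.sum_map_toList]
  calc ∑ w : V, ‖O - twirl w O‖ ≤ ∑ w : V, lipschitzConst O :=
        Finset.sum_le_sum fun w _ => norm_sub_twirl_le_lipschitzConst w O
    _ = Fintype.card V * lipschitzConst O := by simp

/-- The commutator with an operator on two sites is controlled by the Lipschitz constant, by
comparison with the average over one site of an operator trivial at the other. -/
theorem norm_commutator_le_lipschitzConst {u w : V} {K : Op V q} (hK : ActsOn K {v | v ∈ s(u, w)})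
    (O : Op V q) : ‖K * O - O * K‖ ≤ 3 * lipschitzConst O * ‖K‖ := by
  rcases eq_or_lt_of_le (norm_nonneg K) with h0 | h0
  · have : K = 0 := norm_eq_zero.1 h0.symm
    simp [this]
  have key : ‖K * O - O * K‖ / ‖K‖ ≤ 2 * lipschitzConst O + lipschitzConst O := by
    refine le_mul_lipschitzConst (w := w) fun X hX => ?_
    have hY : Commute K (twirl u X) := hK.commute fun v hv => by
      rcases Sym2.mem_iff.1 hv with rfl | rfl
      · exact twirl_trivialAt _ _
      · exact hX.condExp _ _
    have h1 : K * O - O * K = K * (O - twirl u X) - (O - twirl u X) * K := by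
      rw [mul_sub, sub_mul, hY.eq]; abel
    have h2 : ‖O - twirl u X‖ ≤ lipschitzConst O + ‖O - X‖ := by
      have : O - twirl u X = (O - twirl u O) + twirl u (O - X) := by rw [map_sub]; abel
      rw [this]
      exact (norm_add_le _ _).trans (add_le_add (norm_sub_twirl_le_lipschitzConst u O)
        (norm_twirl_le _ _))
    rw [div_le_iff₀ h0, h1]
    calc _ ≤ ‖K‖ * ‖O - twirl u X‖ + ‖O - twirl u X‖ * ‖K‖ :=
          (norm_sub_le _ _).trans (add_le_add (norm_mul_le _ _) (norm_mul_le _ _))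
      _ = 2 * ‖O - twirl u X‖ * ‖K‖ := by ring
      _ ≤ 2 * (lipschitzConst O + ‖O - X‖) * ‖K‖ := by gcongr
      _ = _ := by ring
  rw [div_le_iff₀ h0] at key
  linarith

end Lipschitz

/-! ### One Lieb–Robinson step -/

section LiebRobinsonStep

open scoped Matrix.Norms.L2Operator

variable {V : Type*} [Fintype V] [DecidableEq V] {q : ℕ}

/-- The commutators of `f` with the operators acting on an edge are bounded by `m` times the norm
of the latter. -/
def CommutatorBound (G : SimpleGraph V) (f : Op V q) (m : ℝ) : Prop :=
  ∀ e ∈ G.edgeSet, ∀ K : Op V q, ActsOn K {v | v ∈ e} → ‖K * f - f * K‖ ≤ m * ‖K‖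

theorem CommutatorBound.mono {G : SimpleGraph V} {f : Op V q} {m m' : ℝ}
    (h : CommutatorBound G f m) (hm : m ≤ m') : CommutatorBound G f m' := fun e he K hK =>
  (h e he K hK).trans (mul_le_mul_of_nonneg_right hm (norm_nonneg K))

theorem norm_commutator_le (A B : Op V q) : ‖A * B - B * A‖ ≤ 2 * ‖A‖ * ‖B‖ := by
  refine (norm_sub_le _ _).trans ?_
  have h1 := norm_mul_le A B
  have h2 := norm_mul_le B A
  linarith

theorem norm_one_le : ‖(1 : Op V q)‖ ≤ 1 := by
  have := CStarRing.norm_star_mul_self (x := (1 : Op V q))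
  rw [star_one, one_mul] at this
  by_contra hlt
  nlinarith [norm_nonneg (1 : Op V q)]

theorem card_edges_meeting_le (G : SimpleGraph V) [DecidableRel G.Adj] {e : Sym2 V}
    (he : e ∈ G.edgeSet) :
    ((G.edgeFinset.filter fun e' => ∃ v, v ∈ e ∧ v ∈ e').card : ℝ) ≤ 2 * G.maxDegree - 1 := by
  induction e using Sym2.ind with
  | h x y =>
    have hsub : (G.edgeFinset.filter fun e' => ∃ v, v ∈ s(x, y) ∧ v ∈ e') ⊆
        G.incidenceFinset x ∪ G.incidenceFinset y := by
      intro e' he'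
      obtain ⟨h1, v, hv, hv'⟩ := Finset.mem_filter.1 he'
      rw [Finset.mem_union, SimpleGraph.mem_incidenceFinset, SimpleGraph.mem_incidenceFinset]
      rcases Sym2.mem_iff.1 hv with rfl | rfl
      · exact Or.inl ⟨SimpleGraph.mem_edgeFinset.1 h1, hv'⟩
      · exact Or.inr ⟨SimpleGraph.mem_edgeFinset.1 h1, hv'⟩
    have hint : 0 < (G.incidenceFinset x ∩ G.incidenceFinset y).card := by
      refine Finset.card_pos.2 ⟨s(x, y), ?_⟩
      rw [Finset.mem_inter, SimpleGraph.mem_incidenceFinset, SimpleGraph.mem_incidenceFinset]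
      exact ⟨⟨he, Sym2.mem_mk_left x y⟩, ⟨he, Sym2.mem_mk_right x y⟩⟩
    have hcard := Finset.card_union_add_card_inter (G.incidenceFinset x) (G.incidenceFinset y)
    rw [SimpleGraph.card_incidenceFinset_eq_degree,
      SimpleGraph.card_incidenceFinset_eq_degree] at hcard
    have h1 := Finset.card_le_card hsub
    have hx := G.degree_le_maxDegree x
    have hy := G.degree_le_maxDegree y
    have : (G.edgeFinset.filter fun e' => ∃ v, v ∈ s(x, y) ∧ v ∈ e').card + 1 ≤
        2 * G.maxDegree := by omega
    have h2 : (((G.edgeFinset.filter fun e' => ∃ v, v ∈ s(x, y) ∧ v ∈ e').card + 1 : ℕ) : ℝ) ≤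
        ((2 * G.maxDegree : ℕ) : ℝ) := Nat.cast_le.2 this
    push_cast at h2
    linarith

/-- Conjugation by `𝕀 + iB` is an isometry up to second order in a self-adjoint `B`. -/
theorem norm_conj_le {B g : Op V q} (hB : B.IsHermitian) :
    ‖(1 + Complex.I • B) * g * (1 - Complex.I • B)‖ ≤ (1 + ‖B‖ ^ 2) * ‖g‖ := by
  have hstar : star (1 + Complex.I • B) = 1 - Complex.I • B := by
    rw [star_add, star_one, star_smul, Matrix.star_eq_conjTranspose, hB.eq, Complex.star_def,
      Complex.conj_I, neg_smul, sub_eq_add_neg]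
  have hmul : star (1 + Complex.I • B) * (1 + Complex.I • B) = 1 + B * B := by
    rw [hstar, sub_mul, mul_add, mul_add, smul_mul_smul_comm, Complex.I_mul_I,
      neg_one_smul]
    simp only [one_mul, mul_one]
    abel
  have h2 : ‖1 + Complex.I • B‖ * ‖1 + Complex.I • B‖ ≤ 1 + ‖B‖ ^ 2 := by
    rw [← CStarRing.norm_star_mul_self, hmul, sq]
    exact (norm_add_le _ _).trans (add_le_add norm_one_le (norm_mul_le _ _))
  have h3 : ‖1 - Complex.I • B‖ = ‖1 + Complex.I • B‖ := by rw [← hstar, norm_star]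
  calc _ ≤ ‖1 + Complex.I • B‖ * ‖g‖ * ‖1 - Complex.I • B‖ :=
        (norm_mul_le _ _).trans (mul_le_mul_of_nonneg_right (norm_mul_le _ _) (norm_nonneg _))
    _ = (‖1 + Complex.I • B‖ * ‖1 + Complex.I • B‖) * ‖g‖ := by rw [h3]; ring
    _ ≤ _ := mul_le_mul_of_nonneg_right h2 (norm_nonneg _)

theorem norm_sum_smul_le {ι : Type*} {s : Finset ι} {β : ι → ℝ} {h : ι → Op V q} {c : ℝ}
    (hh : ∀ e ∈ s, ‖h e‖ ≤ 1 / 2) (hβ : ∀ e ∈ s, |β e| ≤ c) :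
    ‖∑ e ∈ s, (β e : ℂ) • h e‖ ≤ s.card * (c / 2) := by
  rw [← nsmul_eq_mul, ← Finset.sum_const]
  refine norm_sum_le_of_le _ fun e he => ?_
  rw [norm_smul, Complex.norm_real, Real.norm_eq_abs, div_eq_mul_one_div]
  exact mul_le_mul (hβ e he) (hh e he) (norm_nonneg _) ((abs_nonneg _).trans (hβ e he))

omit [Fintype V] [DecidableEq V] in
theorem isHermitian_sum_smul {ι : Type*} {s : Finset ι} {β : ι → ℝ} {h : ι → Op V q}
    (hh : ∀ e ∈ s, (h e).IsHermitian) : (∑ e ∈ s, (β e : ℂ) • h e).IsHermitian := by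
  rw [Matrix.IsHermitian, Matrix.conjTranspose_sum]
  refine Finset.sum_congr rfl fun e he => ?_
  rw [Matrix.conjTranspose_smul, (hh e he).eq, Complex.star_def, Complex.conj_ofReal]

/-- One Lieb–Robinson step. For `K` on an edge, the part of `B` which commutes with `K` acts on
`[K, f]` as an infinitesimal isometry; the remaining terms of `B` sit on the at most `2D - 1` edges
meeting that of `K`, and their commutators with `f` are bounded by hypothesis. -/
theorem CommutatorBound.step {G : SimpleGraph V} [DecidableRel G.Adj] {h : Sym2 V → Op V q}
    (hherm : ∀ e ∈ G.edgeSet, (h e).IsHermitian)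
    (hact : ∀ e ∈ G.edgeSet, ActsOn (h e) {v | v ∈ e})
    (hnorm : ∀ e ∈ G.edgeSet, ‖h e‖ ≤ 1 / 2) {β : Sym2 V → ℝ} {c : ℝ}
    (hβ : ∀ e ∈ G.edgeSet, |β e| ≤ c) {f f₀ B : Op V q}
    (hB : B = ∑ e ∈ G.edgeFinset, (β e : ℂ) • h e) {m κ r : ℝ} (hm : 0 ≤ m)
    (hκ : κ = G.edgeFinset.card * (c / 2))
    (hf₀ : ‖f₀ - (1 + Complex.I • B) * f * (1 - Complex.I • B)‖ ≤ r)
    (hf : CommutatorBound G f m) :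
    CommutatorBound G f₀ ((1 + c * (2 * G.maxDegree - 1)) * m + 6 * κ ^ 2 * ‖f‖ + 2 * r) := by
  intro e he K hK
  have hc : 0 ≤ c := (abs_nonneg _).trans (hβ e he)
  have hmem : ∀ {e'}, e' ∈ G.edgeFinset → e' ∈ G.edgeSet := SimpleGraph.mem_edgeFinset.1
  have hBn : ‖B‖ ≤ κ := by
    rw [hB, hκ]
    exact norm_sum_smul_le (fun e' h' => hnorm e' (hmem h')) fun e' h' => hβ e' (hmem h')
  let P : Sym2 V → Prop := fun e' => ∃ v, v ∈ e ∧ v ∈ e'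
  obtain ⟨B₁, hB₁⟩ : ∃ X, X = ∑ e' ∈ G.edgeFinset.filter P, (β e' : ℂ) • h e' := ⟨_, rfl⟩
  obtain ⟨B₂, hB₂⟩ : ∃ X, X = ∑ e' ∈ G.edgeFinset.filter (¬ P ·), (β e' : ℂ) • h e' := ⟨_, rfl⟩
  have hB12 : B = B₁ + B₂ := by
    rw [hB, hB₁, hB₂, Finset.sum_filter_add_sum_filter_not]
  have hmem' : ∀ {e' : Sym2 V} {Q : Sym2 V → Prop} [DecidablePred Q],
      e' ∈ G.edgeFinset.filter Q → e' ∈ G.edgeSet :=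
    fun h' => hmem (Finset.mem_filter.1 h').1
  have hB₂n : ‖B₂‖ ≤ κ := by
    rw [hB₂, hκ]
    refine (norm_sum_smul_le (fun e' h' => hnorm e' (hmem' h'))
      fun e' h' => hβ e' (hmem' h')).trans ?_
    have : ((G.edgeFinset.filter (¬ P ·)).card : ℝ) ≤ G.edgeFinset.card :=
      Nat.cast_le.2 (Finset.card_le_card (Finset.filter_subset _ _))
    gcongr
  have hB₂h : B₂.IsHermitian := by
    rw [hB₂]; exact isHermitian_sum_smul fun e' h' => hherm e' (hmem' h')
  have hκ0 : 0 ≤ κ := (norm_nonneg _).trans hBn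
  -- the terms on edges disjoint from `e` commute with `K`
  have hcomm : Commute K B₂ := by
    rw [hB₂]
    refine Commute.sum_right _ _ _ fun e' h' => Commute.smul_right ?_ _
    refine hK.commute_of_disjoint (hact e' (hmem' h')) (Set.disjoint_left.2 fun v hv hv' => ?_)
    exact (Finset.mem_filter.1 h').2 ⟨v, hv, hv'⟩
  have hB₁f : ‖B₁ * f - f * B₁‖ ≤ (2 * G.maxDegree - 1) * (c * (m / 2)) := by
    have h1 : B₁ * f - f * B₁ =
        ∑ e' ∈ G.edgeFinset.filter P, (β e' : ℂ) • (h e' * f - f * h e') := by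
      rw [hB₁, Finset.sum_mul, Finset.mul_sum, ← Finset.sum_sub_distrib]
      refine Finset.sum_congr rfl fun e' _ => ?_
      rw [smul_mul_assoc, mul_smul_comm, smul_sub]
    rw [h1]
    have h2 : ‖∑ e' ∈ G.edgeFinset.filter P, (β e' : ℂ) • (h e' * f - f * h e')‖ ≤
        ∑ e' ∈ G.edgeFinset.filter P, c * (m / 2) := by
      refine norm_sum_le_of_le _ fun e' h' => ?_
      rw [norm_smul, Complex.norm_real, Real.norm_eq_abs]
      refine mul_le_mul (hβ e' (hmem' h')) ?_ (norm_nonneg _) hc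
      refine (hf e' (hmem' h') _ (hact e' (hmem' h'))).trans ?_
      have := mul_le_mul_of_nonneg_left (hnorm e' (hmem' h')) hm
      linarith
    rw [Finset.sum_const, nsmul_eq_mul] at h2
    exact h2.trans (mul_le_mul_of_nonneg_right (card_edges_meeting_le G he) (by positivity))
  obtain ⟨g, hg⟩ : ∃ g, g = K * f - f * K := ⟨_, rfl⟩
  have hgm : ‖g‖ ≤ m * ‖K‖ := hg ▸ hf e he K hK
  have hg2 : ‖g‖ ≤ 2 * ‖K‖ * ‖f‖ := hg ▸ norm_commutator_le K f
  have hsplit : K * f₀ - f₀ * K =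
      ((1 + Complex.I • B₂) * g * (1 - Complex.I • B₂) - B₂ * g * B₂) +
      Complex.I • (K * (B₁ * f - f * B₁) - (B₁ * f - f * B₁) * K) +
      (K * (B * f * B) - (B * f * B) * K) +
      (K * (f₀ - (1 + Complex.I • B) * f * (1 - Complex.I • B)) -
        (f₀ - (1 + Complex.I • B) * f * (1 - Complex.I • B)) * K) := by
    have hex : ∀ X Y : Op V q, (1 + Complex.I • X) * Y * (1 - Complex.I • X) =
        Y + Complex.I • (X * Y - Y * X) + X * Y * X := by
      intro X Y
      rw [add_mul, one_mul, mul_sub, mul_one, add_mul, mul_smul_comm, smul_mul_assoc,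
        smul_mul_smul_comm, Complex.I_mul_I, smul_sub, neg_one_smul]
      abel
    have hI : K * (Complex.I • (B * f - f * B)) - Complex.I • (B * f - f * B) * K =
        Complex.I • (B₂ * g - g * B₂) +
        Complex.I • (K * (B₁ * f - f * B₁) - (B₁ * f - f * B₁) * K) := by
      rw [mul_smul_comm, smul_mul_assoc, ← smul_sub, ← smul_add, hB12, hg]
      congr 1
      have e1 : K * (B₂ * f) = B₂ * (K * f) := by rw [← mul_assoc, hcomm.eq, mul_assoc]
      have e2 : f * B₂ * K = f * K * B₂ := by rw [mul_assoc, ← hcomm.eq, mul_assoc]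
      have e3 : B₂ * f * K = B₂ * (f * K) := mul_assoc _ _ _
      have e4 : K * (f * B₂) = K * f * B₂ := (mul_assoc _ _ _).symm
      simp only [add_mul, mul_add, mul_sub, sub_mul, e1, e2, e3, e4]
      abel
    rw [hex B₂ g, add_sub_cancel_right, add_assoc g, ← hI, hg, hex B f]
    generalize Complex.I • (B * f - f * B) = Z
    generalize B * f * B = Y
    simp only [mul_sub, sub_mul, mul_add, add_mul]
    abel
  rw [hsplit]
  have t1 : ‖(1 + Complex.I • B₂) * g * (1 - Complex.I • B₂) - B₂ * g * B₂‖ ≤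
      m * ‖K‖ + 4 * κ ^ 2 * ‖f‖ * ‖K‖ := by
    have a1 := norm_conj_le (g := g) hB₂h
    have a2 : ‖B₂ * g * B₂‖ ≤ ‖B₂‖ * ‖g‖ * ‖B₂‖ :=
      (norm_mul_le _ _).trans (mul_le_mul_of_nonneg_right (norm_mul_le _ _) (norm_nonneg _))
    have a3 : ‖B₂‖ ^ 2 ≤ κ ^ 2 := pow_le_pow_left₀ (norm_nonneg _) hB₂n 2
    have a4 : ‖B₂‖ ^ 2 * ‖g‖ ≤ κ ^ 2 * (2 * ‖K‖ * ‖f‖) :=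
      mul_le_mul a3 hg2 (norm_nonneg _) (sq_nonneg _)
    calc _ ≤ (1 + ‖B₂‖ ^ 2) * ‖g‖ + ‖B₂‖ * ‖g‖ * ‖B₂‖ :=
          (norm_sub_le _ _).trans (add_le_add a1 a2)
      _ = ‖g‖ + 2 * (‖B₂‖ ^ 2 * ‖g‖) := by ring
      _ ≤ _ := by linarith
  have t2 : ‖Complex.I • (K * (B₁ * f - f * B₁) - (B₁ * f - f * B₁) * K)‖ ≤
      c * (2 * G.maxDegree - 1) * m * ‖K‖ := by
    rw [norm_smul, Complex.norm_I, one_mul]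
    refine (norm_commutator_le _ _).trans ?_
    have := mul_le_mul_of_nonneg_left hB₁f (mul_nonneg zero_le_two (norm_nonneg K))
    linarith
  have t3 : ‖K * (B * f * B) - (B * f * B) * K‖ ≤ 2 * κ ^ 2 * ‖f‖ * ‖K‖ := by
    refine (norm_commutator_le _ _).trans ?_
    have a1 : ‖B * f * B‖ ≤ κ * ‖f‖ * κ :=
      (norm_mul_le _ _).trans (mul_le_mul ((norm_mul_le _ _).trans
        (mul_le_mul_of_nonneg_right hBn (norm_nonneg _))) hBn (norm_nonneg _) (by positivity))
    have := mul_le_mul_of_nonneg_left a1 (mul_nonneg zero_le_two (norm_nonneg K))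
    linarith
  have t4 : ‖K * (f₀ - (1 + Complex.I • B) * f * (1 - Complex.I • B)) -
      (f₀ - (1 + Complex.I • B) * f * (1 - Complex.I • B)) * K‖ ≤ 2 * r * ‖K‖ := by
    refine (norm_commutator_le _ _).trans ?_
    have := mul_le_mul_of_nonneg_left hf₀ (mul_nonneg zero_le_two (norm_nonneg K))
    linarith
  refine (norm_add_le _ _).trans ((add_le_add (norm_add_le _ _) le_rfl).trans
    ((add_le_add (add_le_add (norm_add_le _ _) le_rfl) le_rfl).trans ?_))
  linarith

end LiebRobinsonStep

/-! ### Growth of commutators under the evolution -/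

section Evolution

open scoped Matrix.Norms.L2Operator

variable {V : Type*} [Fintype V] [DecidableEq V] {q : ℕ} {G : SimpleGraph V} [DecidableRel G.Adj]
  {h : Sym2 V → Op V q} {α : Sym2 V → ℝ → ℝ} {b : ℝ} {U : ℝ → Op V q}

theorem IsLocalProcess.norm_term_le (hU : IsLocalProcess G h α b U) {e : Sym2 V}
    (he : e ∈ G.edgeFinset) : ‖h e‖ ≤ 1 / 2 := by
  rw [← opNorm_eq_norm]
  exact hU.norm_le e (SimpleGraph.mem_edgeFinset.1 he)

theorem IsLocalProcess.intervalIntegrable_coupling (hU : IsLocalProcess G h α b U) {e : Sym2 V}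
    (he : e ∈ G.edgeFinset) {s s' : ℝ} (hs : 0 ≤ s) (hss : s ≤ s') :
    IntervalIntegrable (fun r => (α e r : ℂ)) MeasureTheory.volume s s' := by
  have he' := SimpleGraph.mem_edgeFinset.1 he
  rw [intervalIntegrable_iff_integrableOn_Ioc_of_le hss]
  refine MeasureTheory.Measure.integrableOn_of_bounded (M := b) (by simp)
    (Complex.measurable_ofReal.comp (hU.measurable e he')).aestronglyMeasurable ?_
  refine MeasureTheory.ae_restrict_of_forall_mem measurableSet_Ioc fun r hr => ?_
  rw [Complex.norm_real, Real.norm_eq_abs]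
  exact hU.coupling_le e he' r (hs.trans hr.1.le)

theorem IsLocalProcess.continuousOn (hU : IsLocalProcess G h α b U) :
    ContinuousOn U (Set.Ici 0) :=
  continuousOn_pi.2 fun σ => continuousOn_pi.2 fun τ => hU.evolution.continuousOn σ τ

theorem IsLocalProcess.intervalIntegrable_term (hU : IsLocalProcess G h α b U) {e : Sym2 V}
    (he : e ∈ G.edgeFinset) {s s' : ℝ} (hs : 0 ≤ s) (hss : s ≤ s') :
    IntervalIntegrable (fun r => (α e r : ℂ) • (h e * U r)) MeasureTheory.volume s s' := by
  refine (hU.intervalIntegrable_coupling he hs hss).smul_continuousOn ?_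
  refine continuousOn_const.mul (hU.continuousOn.mono fun r hr => ?_)
  rw [Set.uIcc_of_le hss] at hr
  exact hs.trans hr.1

theorem IsLocalProcess.eq_one_sub_integral (hU : IsLocalProcess G h α b U) {t : ℝ} (ht : 0 ≤ t) :
    U t = 1 - Complex.I • ∑ e ∈ G.edgeFinset, ∫ s in (0 : ℝ)..t, (α e s : ℂ) • (h e * U s) := by
  ext σ τ
  rw [hU.evolution.schrodinger t ht σ τ, Matrix.sub_apply, Matrix.smul_apply, smul_eq_mul,
    Matrix.sum_apply]
  congr 2
  let L : Op V q →L[ℂ] ℂ := LinearMap.toContinuousLinearMap (Matrix.entryLinearMap ℂ ℂ σ τ)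
  have hL : ∀ X : Op V q, L X = X σ τ := fun X => rfl
  have hint : ∀ e ∈ G.edgeFinset, IntervalIntegrable
      (fun s => L ((α e s : ℂ) • (h e * U s))) MeasureTheory.volume 0 t := fun e he =>
    ⟨L.integrable_comp (hU.intervalIntegrable_term he le_rfl ht).1,
      L.integrable_comp (hU.intervalIntegrable_term he le_rfl ht).2⟩
  calc ∫ s in (0 : ℝ)..t, (hamiltonian G h α s * U s) σ τ
      = ∫ s in (0 : ℝ)..t, ∑ e ∈ G.edgeFinset, L ((α e s : ℂ) • (h e * U s)) := by
        refine intervalIntegral.integral_congr fun s _ => ?_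
        simp only [hL, hamiltonian, Finset.sum_mul, smul_mul_assoc, Matrix.sum_apply]
    _ = ∑ e ∈ G.edgeFinset, ∫ s in (0 : ℝ)..t, L ((α e s : ℂ) • (h e * U s)) :=
        intervalIntegral.integral_finsetSum hint
    _ = _ := Finset.sum_congr rfl fun e he => by
        rw [L.intervalIntegral_comp_comm (hU.intervalIntegrable_term he le_rfl ht), hL]

theorem IsLocalProcess.sub_eq_integral (hU : IsLocalProcess G h α b U) {s s' : ℝ} (hs : 0 ≤ s)
    (hss : s ≤ s') :
    U s - U s' =
      Complex.I • ∑ e ∈ G.edgeFinset, ∫ r in s..s', (α e r : ℂ) • (h e * U r) := by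
  rw [hU.eq_one_sub_integral hs, hU.eq_one_sub_integral (hs.trans hss), sub_sub_sub_cancel_left,
    ← smul_sub, ← Finset.sum_sub_distrib]
  congr 1
  refine Finset.sum_congr rfl fun e he => ?_
  exact intervalIntegral.integral_interval_sub_left
    (hU.intervalIntegrable_term he le_rfl (hs.trans hss)) (hU.intervalIntegrable_term he le_rfl hs)

theorem norm_le_one_of_mem_unitaryGroup {A : Op V q}
    (hA : A ∈ Matrix.unitaryGroup (V → Fin q) ℂ) : ‖A‖ ≤ 1 := by
  have h1 : ‖star A * A‖ = ‖A‖ * ‖A‖ := CStarRing.norm_star_mul_self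
  rw [(Unitary.mem_iff.1 hA).1] at h1
  have h2 := norm_one_le (V := V) (q := q)
  by_contra hlt
  nlinarith

/-- The integral over `[s, s']` of the Hamiltonian against operators of norm at most `C`. -/
theorem IsLocalProcess.norm_sum_integral_le (hU : IsLocalProcess G h α b U) {s s' C : ℝ}
    (hs : 0 ≤ s) (hss : s ≤ s') {W : ℝ → Op V q} (hW : ∀ r ∈ Set.Icc s s', ‖W r‖ ≤ C) :
    ‖∑ e ∈ G.edgeFinset, ∫ r in s..s', (α e r : ℂ) • (h e * W r)‖ ≤
      G.edgeFinset.card * (b * (s' - s) / 2) * C := by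
  have h1 : ‖∑ e ∈ G.edgeFinset, ∫ r in s..s', (α e r : ℂ) • (h e * W r)‖ ≤
      ∑ e ∈ G.edgeFinset, b * (1 / 2 * C) * (s' - s) := by
    refine norm_sum_le_of_le _ fun e he => ?_
    rw [← abs_of_nonneg (sub_nonneg.2 hss)]
    refine intervalIntegral.norm_integral_le_of_norm_le_const fun r hr => ?_
    rw [Set.uIoc_of_le hss] at hr
    have hα := hU.coupling_le e (SimpleGraph.mem_edgeFinset.1 he) r (hs.trans hr.1.le)
    rw [norm_smul, Complex.norm_real, Real.norm_eq_abs]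
    refine mul_le_mul hα ((norm_mul_le _ _).trans ?_) (norm_nonneg _) ((abs_nonneg _).trans hα)
    exact mul_le_mul (hU.norm_term_le he) (hW r ⟨hr.1.le, hr.2⟩) (norm_nonneg _) (by norm_num)
  rw [Finset.sum_const, nsmul_eq_mul] at h1
  refine h1.trans (le_of_eq ?_)
  ring

/-- To second order, the evolution over `[s, s']` is given by the integrated Hamiltonian. -/
theorem IsLocalProcess.norm_sub_le (hU : IsLocalProcess G h α b U) {s s' κ : ℝ} (hs : 0 ≤ s)
    (hss : s ≤ s') (hκ : κ = G.edgeFinset.card * (b * (s' - s) / 2)) {B : Op V q}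
    (hB : B = ∑ e ∈ G.edgeFinset, ((∫ r in s..s', α e r : ℝ) : ℂ) • h e) :
    ‖U s - (1 + Complex.I • B) * U s'‖ ≤ κ ^ 2 := by
  have hunit : ∀ r, 0 ≤ r → ‖U r‖ ≤ 1 := fun r hr =>
    norm_le_one_of_mem_unitaryGroup (hU.evolution.unitary r hr)
  have hsb : ∀ r ∈ Set.Icc s s', ‖U r - U s'‖ ≤ κ := by
    intro r hr
    have h0 : 0 ≤ r := hs.trans hr.1
    have := hU.norm_sum_integral_le (C := 1) h0 hr.2 (W := U)
      fun u hu => hunit u (h0.trans hu.1)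
    rw [hU.sub_eq_integral h0 hr.2, norm_smul, Complex.norm_I, one_mul]
    refine this.trans ?_
    rw [mul_one, hκ]
    rcases G.edgeFinset.eq_empty_or_nonempty with h | ⟨e, he⟩
    · simp [h]
    · have hb : 0 ≤ b := (abs_nonneg _).trans
        (hU.coupling_le e (SimpleGraph.mem_edgeFinset.1 he) 0 le_rfl)
      have := hr.1
      gcongr
  have key : U s - (1 + Complex.I • B) * U s' =
      Complex.I • ∑ e ∈ G.edgeFinset, ∫ r in s..s', (α e r : ℂ) • (h e * (U r - U s')) := by
    rw [add_mul, one_mul, ← sub_sub, hU.sub_eq_integral hs hss, smul_mul_assoc, ← smul_sub, hB,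
      Finset.sum_mul, ← Finset.sum_sub_distrib]
    congr 1
    refine Finset.sum_congr rfl fun e he => ?_
    simp only [mul_sub, smul_sub]
    rw [intervalIntegral.integral_sub (hU.intervalIntegrable_term he hs hss)
      ((hU.intervalIntegrable_coupling he hs hss).smul_continuousOn continuousOn_const),
      intervalIntegral.integral_smul_const, intervalIntegral.integral_ofReal, smul_mul_assoc]
  rw [key, norm_smul, Complex.norm_I, one_mul, sq]
  refine (hU.norm_sum_integral_le hs hss hsb).trans ?_
  rw [hκ]

/-- The commutator bound after a small backward step of length `s' - s` of the evolution. -/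
theorem IsLocalProcess.commutatorBound_step (hU : IsLocalProcess G h α b U) (O : Op V q)
    {s s' m κ t : ℝ} (hs : 0 ≤ s) (hss : s ≤ s') (hst : s' ≤ t) (hm : 0 ≤ m)
    (hκ : κ = G.edgeFinset.card * (b / 2))
    (hf : CommutatorBound G (U s' * O * (U s')ᴴ) m) :
    CommutatorBound G (U s * O * (U s)ᴴ) ((1 + b * (2 * G.maxDegree - 1) * (s' - s)) * m +
      (6 * κ ^ 2 + 2 * κ ^ 2 * (2 + (κ * t) ^ 2)) * ‖O‖ * (s' - s) ^ 2) := by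
  rcases G.edgeFinset.eq_empty_or_nonempty with hE | ⟨e₀, he₀⟩
  · intro e he
    rw [← SimpleGraph.mem_edgeFinset, hE] at he
    simp at he
  have hb : 0 ≤ b := (abs_nonneg _).trans
    (hU.coupling_le e₀ (SimpleGraph.mem_edgeFinset.1 he₀) 0 le_rfl)
  have hη : 0 ≤ s' - s := sub_nonneg.2 hss
  obtain ⟨B, hB⟩ : ∃ B, B = ∑ e ∈ G.edgeFinset, ((∫ r in s..s', α e r : ℝ) : ℂ) • h e := ⟨_, rfl⟩
  have hβ : ∀ e ∈ G.edgeSet, |∫ r in s..s', α e r| ≤ b * (s' - s) := by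
    intro e he
    have := intervalIntegral.norm_integral_le_of_norm_le_const (a := s) (b := s') (f := α e)
      (C := b) fun r hr => by
        rw [Set.uIoc_of_le hss] at hr
        exact hU.coupling_le e he r (hs.trans hr.1.le)
    rwa [abs_of_nonneg hη] at this
  obtain ⟨κ', hκ'⟩ : ∃ x, x = (G.edgeFinset.card : ℝ) * (b * (s' - s) / 2) := ⟨_, rfl⟩
  have hκκ' : κ' = κ * (s' - s) := by rw [hκ', hκ]; ring
  have hκ0 : 0 ≤ κ := by rw [hκ]; positivity
  have hUs := norm_le_one_of_mem_unitaryGroup (hU.evolution.unitary s hs)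
  have hUs' := norm_le_one_of_mem_unitaryGroup (hU.evolution.unitary s' (hs.trans hss))
  have hBh : B.IsHermitian := by
    rw [hB]
    exact isHermitian_sum_smul fun e he => hU.selfAdjoint e (SimpleGraph.mem_edgeFinset.1 he)
  have hδ := hU.norm_sub_le hs hss hκ' hB
  obtain ⟨Z, hZ⟩ : ∃ Z, Z = (1 + Complex.I • B) * U s' := ⟨_, rfl⟩
  rw [← hZ] at hδ
  have hZn : ‖Z‖ ≤ 1 + κ' ^ 2 := by
    have : Z = U s - (U s - Z) := by abel
    rw [this]
    exact (_root_.norm_sub_le _ _).trans (add_le_add hUs hδ)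
  have hf₀ : ‖U s * O * (U s)ᴴ - (1 + Complex.I • B) * (U s' * O * (U s')ᴴ) *
      (1 - Complex.I • B)‖ ≤ κ' ^ 2 * ‖O‖ * (2 + κ' ^ 2) := by
    have hZstar : Zᴴ = (U s')ᴴ * (1 - Complex.I • B) := by
      rw [hZ, Matrix.conjTranspose_mul, Matrix.conjTranspose_add, Matrix.conjTranspose_one,
        Matrix.conjTranspose_smul, hBh.eq, Complex.star_def, Complex.conj_I, neg_smul,
        sub_eq_add_neg]
    have h1 : U s * O * (U s)ᴴ - (1 + Complex.I • B) * (U s' * O * (U s')ᴴ) *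
        (1 - Complex.I • B) = (U s - Z) * O * (U s)ᴴ + Z * O * (U s - Z)ᴴ := by
      rw [Matrix.conjTranspose_sub, hZstar, hZ]
      simp only [sub_mul, mul_sub, mul_assoc]
      abel
    rw [h1]
    have h2 : ‖(U s - Z) * O * (U s)ᴴ‖ ≤ κ' ^ 2 * ‖O‖ * 1 :=
      (norm_mul_le _ _).trans (mul_le_mul ((norm_mul_le _ _).trans
        (mul_le_mul_of_nonneg_right hδ (norm_nonneg _)))
        ((Matrix.l2_opNorm_conjTranspose _).trans_le hUs) (norm_nonneg _) (by positivity))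
    have h3 : ‖Z * O * (U s - Z)ᴴ‖ ≤ (1 + κ' ^ 2) * ‖O‖ * κ' ^ 2 :=
      (norm_mul_le _ _).trans (mul_le_mul ((norm_mul_le _ _).trans
        (mul_le_mul_of_nonneg_right hZn (norm_nonneg _)))
        ((Matrix.l2_opNorm_conjTranspose _).trans_le hδ) (norm_nonneg _) (by positivity))
    refine (norm_add_le _ _).trans ((add_le_add h2 h3).trans (le_of_eq ?_))
    ring
  have hfn : ‖U s' * O * (U s')ᴴ‖ ≤ ‖O‖ := by
    calc _ ≤ 1 * ‖O‖ * 1 := (norm_mul_le _ _).trans (mul_le_mul ((norm_mul_le _ _).trans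
          (mul_le_mul_of_nonneg_right hUs' (norm_nonneg _)))
          ((Matrix.l2_opNorm_conjTranspose _).trans_le hUs') (norm_nonneg _) (by positivity))
      _ = ‖O‖ := by ring
  refine (CommutatorBound.step hU.selfAdjoint hU.actsOn
    (fun e he => hU.norm_term_le (SimpleGraph.mem_edgeFinset.2 he)) hβ hB hm hκ' hf₀ hf).mono ?_
  have hκt : κ' ^ 2 ≤ (κ * t) ^ 2 := by
    rw [hκκ']
    have : s' - s ≤ t := by linarith
    gcongr
  calc _ ≤ (1 + b * (s' - s) * (2 * G.maxDegree - 1)) * m + 6 * κ' ^ 2 * ‖O‖ +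
        2 * (κ' ^ 2 * ‖O‖ * (2 + (κ * t) ^ 2)) := by gcongr
    _ = _ := by rw [hκκ']; ring

/-- The Lieb–Robinson bound without spatial decay: commutators of the evolved observable with
operators on an edge grow at most exponentially in time. -/
theorem IsLocalProcess.commutatorBound (hU : IsLocalProcess G h α b U) {O : Op V q} {m t : ℝ}
    (hm : 0 ≤ m) (ht : 0 ≤ t) (hO : CommutatorBound G O m) :
    CommutatorBound G ((U t)ᴴ * O * U t)
      (Real.exp (b * (2 * G.maxDegree - 1) * t) * m) := by
  intro e he K hK
  have hb : 0 ≤ b := (abs_nonneg _).trans (hU.coupling_le e he 0 le_rfl)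
  have hD : (0 : ℝ) ≤ 2 * G.maxDegree - 1 :=
    (Nat.cast_nonneg _).trans (card_edges_meeting_le G he)
  obtain ⟨v, hv⟩ : ∃ v, v = b * (2 * (G.maxDegree : ℝ) - 1) := ⟨_, rfl⟩
  have hv0 : 0 ≤ v := hv ▸ mul_nonneg hb hD
  obtain ⟨κ, hκ⟩ : ∃ κ, κ = (G.edgeFinset.card : ℝ) * (b / 2) := ⟨_, rfl⟩
  obtain ⟨O', hO'⟩ : ∃ X, X = (U t)ᴴ * O * U t := ⟨_, rfl⟩
  obtain ⟨C, hC⟩ : ∃ C, C = (6 * κ ^ 2 + 2 * κ ^ 2 * (2 + (κ * t) ^ 2)) * ‖O'‖ := ⟨_, rfl⟩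
  have hC0 : 0 ≤ C := by rw [hC]; positivity
  rw [← hO', ← hv]
  have hUt := hU.evolution.unitary t ht
  have hfin : U t * O' * (U t)ᴴ = O := by
    have h1 : U t * (U t)ᴴ = 1 := (Unitary.mem_iff.1 hUt).2
    rw [hO', ← mul_assoc, ← mul_assoc, h1, one_mul, mul_assoc, h1, mul_one]
  have hinit : U 0 * O' * (U 0)ᴴ = O' := by
    have h1 : U 0 = 1 := by
      rw [hU.eq_one_sub_integral le_rfl]; simp
    rw [h1, Matrix.conjTranspose_one, one_mul, mul_one]
  -- `N` steps of length `t / N`, each with an error of second order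
  have hN : ∀ N : ℕ, 0 < N →
      CommutatorBound G O' (Real.exp (v * t) * (m + C * t ^ 2 / N)) := by
    intro N hN
    have hNr : (0 : ℝ) < N := Nat.cast_pos.2 hN
    obtain ⟨η, hη⟩ : ∃ η, η = t / N := ⟨_, rfl⟩
    have hη0 : 0 ≤ η := hη ▸ div_nonneg ht hNr.le
    have hNη : N * η = t := by rw [hη]; field_simp
    have key : ∀ k : ℕ, k ≤ N → CommutatorBound G (U (t - k * η) * O' * (U (t - k * η))ᴴ)
        (Real.exp (v * (k * η)) * (m + k * (C * η ^ 2))) := by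
      intro k
      induction k with
      | zero => intro _; simpa [hfin] using hO
      | succ k ih =>
        intro hk
        have hkN : ((k : ℝ) + 1) * η ≤ t := by
          rw [← hNη]
          exact mul_le_mul_of_nonneg_right (by exact_mod_cast hk) hη0
        have hkη : 0 ≤ (k : ℝ) * η := mul_nonneg (Nat.cast_nonneg _) hη0
        have hstep := hU.commutatorBound_step O' (s := t - (k + 1 : ℕ) * η) (s' := t - k * η)
          (t := t) (by push_cast; linarith) (by push_cast; linarith) (by linarith)
          (by positivity) hκ (ih (by omega))
        refine hstep.mono ?_
        have hd : t - (k : ℝ) * η - (t - ((k + 1 : ℕ) : ℝ) * η) = η := by push_cast; ring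
        rw [hd, ← hC, ← hv]
        have h1 : 1 + v * η ≤ Real.exp (v * η) := by
          rw [add_comm]; exact Real.add_one_le_exp _
        have h2 : 1 ≤ Real.exp (v * ((k + 1 : ℕ) * η)) := Real.one_le_exp (by positivity)
        have h3 : Real.exp (v * ((k + 1 : ℕ) * η)) = Real.exp (v * η) * Real.exp (v * (k * η)) := by
          rw [← Real.exp_add]; congr 1; push_cast; ring
        have h4 : 0 ≤ C * η ^ 2 := by positivity
        calc (1 + v * η) * (Real.exp (v * (k * η)) * (m + k * (C * η ^ 2))) + C * η ^ 2
            ≤ Real.exp (v * η) * (Real.exp (v * (k * η)) * (m + k * (C * η ^ 2))) +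
              Real.exp (v * ((k + 1 : ℕ) * η)) * (C * η ^ 2) := by
              refine add_le_add (mul_le_mul_of_nonneg_right h1 (by positivity)) ?_
              exact le_mul_of_one_le_left h4 h2
          _ = Real.exp (v * ((k + 1 : ℕ) * η)) * (m + (k + 1 : ℕ) * (C * η ^ 2)) := by
              rw [h3]; push_cast; ring
    have := key N le_rfl
    rw [hNη, sub_self, hinit] at this
    refine this.mono (le_of_eq ?_)
    rw [hη]
    field_simp
  have hlim : Filter.Tendsto (fun N : ℕ => Real.exp (v * t) * (m + C * t ^ 2 / N) * ‖K‖)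
      Filter.atTop (nhds (Real.exp (v * t) * (m + 0) * ‖K‖)) :=
    ((tendsto_const_nhds.add (tendsto_const_div_atTop_nhds_zero_nat _)).const_mul _).mul_const _
  rw [add_zero] at hlim
  refine ge_of_tendsto hlim ?_
  filter_upwards [Filter.eventually_gt_atTop 0] with N hN'
  exact hN N hN' e he K hK

end Evolution

/-! ### Distances of labels -/

section Labels

variable {V : Type*} {G : SimpleGraph V} {v₀ : V}

theorem exists_dist_eq_of_le (hG : G.Connected) {v w : V} {k : ℕ}
    (hk : k ≤ G.dist v w) : ∃ u, G.dist v u = k := by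
  obtain ⟨p, hp⟩ := hG.exists_walk_length_eq_dist v w
  refine ⟨p.getVert k, le_antisymm ?_ ?_⟩
  · refine (SimpleGraph.dist_le (p.take k)).trans ?_
    rw [SimpleGraph.Walk.take_length]
    exact min_le_left _ _
  · have h1 := SimpleGraph.dist_le (p.drop k)
    rw [SimpleGraph.Walk.drop_length] at h1
    have h2 := hG.dist_triangle (u := v) (v := p.getVert k) (w := w)
    omega

theorem labelDist_eq {n : ℕ} {x : Fin n ≃ V} (hx : IsDistanceOrdering G v₀ x) (k : Fin n) :
    labelDist G v₀ x (k + 1) = G.dist v₀ (x k) := by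
  refine le_antisymm (Nat.sInf_le ⟨k, le_rfl, rfl⟩) ?_
  refine le_csInf ⟨_, k, le_rfl, rfl⟩ ?_
  rintro m ⟨j, hj, rfl⟩
  exact hx.2 k j (by rw [Fin.le_def]; omega)

theorem firstFarLabel_mem {n : ℕ} (x : Fin n ≃ V) (δ : ℝ) :
    firstFarLabel G v₀ x δ ∈ {i | 1 ≤ i ∧ i ≤ n ∧ 2 * δ - 1 ≤ (labelDist G v₀ x i : ℝ)} ∪ {n + 1} :=
  Nat.sInf_mem ⟨n + 1, Or.inr rfl⟩

/-- The vertex `v₀` itself is not far, so that the first far label is at least two. -/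
theorem two_le_firstFarLabel {n : ℕ} {x : Fin n ≃ V} (hx : IsDistanceOrdering G v₀ x) {δ : ℝ}
    (hδ : 1 ≤ δ) : 2 ≤ firstFarLabel G v₀ x δ := by
  have hn : 0 < n := (x.symm v₀).pos
  rcases firstFarLabel_mem (G := G) (v₀ := v₀) x δ with ⟨h1, -, h3⟩ | h
  · by_contra hlt
    have h4 : firstFarLabel G v₀ x δ = 1 := by omega
    have h5 := labelDist_eq hx ⟨0, hn⟩
    rw [hx.1 ⟨0, hn⟩ rfl, SimpleGraph.dist_self, zero_add] at h5
    rw [h4, h5] at h3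
    norm_num at h3
    linarith
  · rw [Set.mem_singleton_iff] at h
    omega

/-- Every distance below that of the first far label is attained, at a smaller label. -/
theorem exists_label_lt (hG : G.Connected) {n : ℕ} {x : Fin n ≃ V}
    (hx : IsDistanceOrdering G v₀ x) {δ : ℝ} (hle : firstFarLabel G v₀ x δ ≤ n)
    (h1 : 1 ≤ firstFarLabel G v₀ x δ) {k : ℕ}
    (hk : k < labelDist G v₀ x (firstFarLabel G v₀ x δ)) :
    ∃ j : Fin n, (j : ℕ) + 1 < firstFarLabel G v₀ x δ ∧ G.dist v₀ (x j) = k := by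
  have hd := labelDist_eq hx ⟨firstFarLabel G v₀ x δ - 1, by omega⟩
  simp only [Nat.sub_add_cancel h1] at hd
  obtain ⟨u, hu⟩ := exists_dist_eq_of_le hG (hk.le.trans_eq hd)
  refine ⟨x.symm u, ?_, by rw [x.apply_symm_apply, hu]⟩
  by_contra hlt
  have h2 := hx.2 ⟨firstFarLabel G v₀ x δ - 1, by omega⟩ (x.symm u)
    (by rw [Fin.le_def]; simp only; omega)
  rw [x.apply_symm_apply, hu, ← hd] at h2
  omega

theorem labelDist_firstFarLabel_le (hG : G.Connected) {n : ℕ} {x : Fin n ≃ V}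
    (hx : IsDistanceOrdering G v₀ x) {δ : ℝ} (hle : firstFarLabel G v₀ x δ ≤ n)
    (h1 : 1 ≤ firstFarLabel G v₀ x δ) :
    labelDist G v₀ x (firstFarLabel G v₀ x δ) ≤ firstFarLabel G v₀ x δ - 1 := by
  have : NeZero n := ⟨by omega⟩
  choose! j hj hdist using fun k (hk : k < _) => exists_label_lt (k := k) hG hx hle h1 hk
  have hcard := Finset.card_le_card_of_injOn (s := Finset.range (labelDist G v₀ x
    (firstFarLabel G v₀ x δ))) (t := Finset.range (firstFarLabel G v₀ x δ - 1))
    (fun k => (j k : ℕ)) (fun k hk => ?_) (fun k hk l hl hkl => ?_)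
  · simpa using hcard
  · have := hj k (by simpa using hk)
    simp only [Finset.coe_range, Set.mem_Iio]
    omega
  · have e1 := hdist k (by simpa using hk)
    have e2 := hdist l (by simpa using hl)
    rw [← e1, ← e2, Fin.ext hkl]

/-- The distances from `v₀` have no gaps, so that the first distance which is at least `2δ - 1` is
less than `2δ`. -/
theorem labelDist_firstFarLabel_lt (hG : G.Connected) {n : ℕ} {x : Fin n ≃ V}
    (hx : IsDistanceOrdering G v₀ x) {δ : ℝ} (hle : firstFarLabel G v₀ x δ ≤ n)
    (h1 : 1 ≤ firstFarLabel G v₀ x δ)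
    (hpos : 1 ≤ labelDist G v₀ x (firstFarLabel G v₀ x δ)) :
    (labelDist G v₀ x (firstFarLabel G v₀ x δ) : ℝ) < 2 * δ := by
  obtain ⟨j, hj, hdist⟩ := exists_label_lt hG hx hle h1
    (k := labelDist G v₀ x (firstFarLabel G v₀ x δ) - 1) (by omega)
  have hnot := Nat.notMem_of_lt_sInf hj
  rw [← labelDist_eq hx] at hdist
  have h2 : ¬ (2 * δ - 1 ≤ (labelDist G v₀ x (j + 1) : ℝ)) := fun h =>
    hnot (Or.inl ⟨by omega, by omega, h⟩)
  rw [hdist, Nat.cast_sub hpos] at h2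
  push_cast at h2
  linarith

/-- The sphere of radius one around an edge at a vertex of maximal degree has at least `D - 1`
elements. -/
theorem HasSpatialDim.maxDegree_sub_one_le [Fintype V] [DecidableEq V]
    [DecidableRel G.Adj] {δ M : ℝ}
    (h : HasSpatialDim G δ M) (hD : 1 ≤ G.maxDegree) : (G.maxDegree : ℝ) - 1 ≤ M := by
  have : Nonempty V := by
    by_contra hne
    rw [not_nonempty_iff] at hne
    rw [SimpleGraph.maxDegree_of_subsingleton] at hD
    omega
  obtain ⟨v, hv⟩ := G.exists_maximal_degree_vertex
  have hpos : 0 < G.degree v := by omega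
  obtain ⟨y, hy⟩ := (G.degree_pos_iff_exists_adj v).1 hpos
  have h1 := h s(v, y) hy 1 le_rfl
  rw [Nat.cast_one, Real.one_rpow, mul_one] at h1
  refine le_trans ?_ h1
  have hsub : (((G.neighborFinset v).erase y).image fun z => s(v, z) : Finset (Sym2 V)) ≤
      (edgeSphere G s(v, y) 1).toFinite.toFinset := by
    intro e' he'
    obtain ⟨z, hz, rfl⟩ := Finset.mem_image.1 he'
    obtain ⟨hzy, hz⟩ := Finset.mem_erase.1 hz
    rw [SimpleGraph.mem_neighborFinset] at hz
    rw [Set.Finite.mem_toFinset]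
    refine ⟨hz, ?_⟩
    rw [edgeDist, if_neg (fun h => hzy (Sym2.congr_right.1 h).symm)]
    refine le_antisymm (Nat.sInf_le ⟨v, Sym2.mem_mk_left _ _, v, Sym2.mem_mk_left _ _, by simp⟩) ?_
    refine le_csInf ⟨_, v, Sym2.mem_mk_left _ _, v, Sym2.mem_mk_left _ _, rfl⟩ ?_
    rintro k ⟨a, -, b, -, rfl⟩
    omega
  have hcard := Finset.card_le_card hsub
  rw [Finset.card_image_of_injective _ (fun a b hab => Sym2.congr_right.1 hab),
    Finset.card_erase_of_mem (by simpa using hy), SimpleGraph.card_neighborFinset_eq_degree, ← hv,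
    ← Set.ncard_eq_toFinset_card] at hcard
  have h2 : ((G.maxDegree - 1 : ℕ) : ℝ) ≤ ((edgeSphere G s(v, y) 1).ncard : ℝ) :=
    Nat.cast_le.2 hcard
  rwa [Nat.cast_sub hD, Nat.cast_one] at h2

theorem card_le_two_of_maxDegree_le_one [Fintype V] [DecidableEq V] [DecidableRel G.Adj]
    (hG : G.Connected) (hD : G.maxDegree ≤ 1) : Fintype.card V ≤ 2 := by
  have h1 := hG.card_vert_le_card_edgeSet_add_one
  have h2 := G.sum_degrees_eq_twice_card_edges
  have h3 : ∑ v, G.degree v ≤ Fintype.card V := by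
    calc ∑ v, G.degree v ≤ ∑ _v : V, 1 :=
          Finset.sum_le_sum fun v _ => (G.degree_le_maxDegree v).trans hD
      _ = Fintype.card V := by simp
  rw [Nat.card_eq_fintype_card, Nat.card_eq_fintype_card, ← SimpleGraph.edgeFinset_card] at h1
  omega

end Labels

/-! ### Comparison of the growth with the first far term -/

section Numerics

theorem exp_neg_half_exp_one_ge : (27 / 128 : ℝ) ≤ Real.exp (-(Real.exp 1 / 2)) := by
  have he := Real.exp_one_lt_d9
  have h1 : Real.exp (Real.exp 1 / 2) ≤ 128 / 27 := by
    have h2 : Real.exp (Real.exp 1 / 2) ≤ Real.exp (3 / 2) :=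
      Real.exp_le_exp.2 (by linarith)
    have h3 : Real.exp (3 / 2) ^ 2 = Real.exp 1 ^ 3 := by
      rw [← Real.exp_nat_mul, ← Real.exp_nat_mul]; norm_num
    have h4 : Real.exp 1 ^ 3 ≤ 2.7182818286 ^ 3 :=
      pow_le_pow_left₀ (Real.exp_pos _).le he.le 3
    have h5 : Real.exp (3 / 2) ≤ 128 / 27 := by
      refine (pow_le_pow_iff_left₀ (Real.exp_pos _).le (by norm_num) two_ne_zero).1 ?_
      rw [h3]
      exact h4.trans (by norm_num)
    exact h2.trans h5
  rw [Real.exp_neg, show (27 / 128 : ℝ) = (128 / 27)⁻¹ by norm_num]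
  exact inv_anti₀ (Real.exp_pos _) h1

/-- For `d ≥ 1` and `δ ≥ d/2` `d^δ e^(-d)` is at least `d^(d/2) e^(-d)`, whose minimum is
`e^(-e/2)`, attained at `d = e`. -/
theorem rpow_mul_exp_neg_ge {d δ : ℝ} (hd : 1 ≤ d) (hδ : d ≤ 2 * δ) :
    Real.exp (-(Real.exp 1 / 2)) ≤ d ^ δ * Real.exp (-d) := by
  have hd0 : 0 < d := by linarith
  rw [Real.rpow_def_of_pos hd0, ← Real.exp_add]
  refine Real.exp_le_exp.2 ?_
  have hlog : 0 ≤ Real.log d := Real.log_nonneg hd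
  have h1 := Real.log_le_sub_one_of_pos (x := Real.exp 1 / d) (by positivity)
  rw [Real.log_div (Real.exp_ne_zero _) hd0.ne', Real.log_exp] at h1
  have h2 : (1 - Real.log d) * d ≤ (Real.exp 1 / d - 1) * d :=
    mul_le_mul_of_nonneg_right h1 hd0.le
  have h3 : (Real.exp 1 / d - 1) * d = Real.exp 1 - d := by field_simp
  have h4 : Real.log d * (d / 2) ≤ Real.log d * δ :=
    mul_le_mul_of_nonneg_left (by linarith) hlog
  linarith

/-- The growth factor `y`, with `y² ≤ e^s`, is dominated by the contribution of the first far
label alone. -/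
theorem three_mul_le {d δ s y : ℝ} (hd : 1 ≤ d) (hδ : d ≤ 2 * δ) (hy : y ^ 2 ≤ Real.exp s) :
    3 * y ≤ 4 * d + 8 / 3 * (d ^ (δ - 1) * Real.exp (s - d)) := by
  have hd0 : 0 < d := by linarith
  have hp : 27 / 128 ≤ d * (d ^ (δ - 1) * Real.exp (-d)) := by
    rw [← mul_assoc, mul_comm d, ← Real.rpow_add_one hd0.ne', sub_add_cancel]
    exact exp_neg_half_exp_one_ge.trans (rpow_mul_exp_neg_ge hd hδ)
  obtain ⟨p, hpd⟩ : ∃ p, p = d ^ (δ - 1) * Real.exp (-d) := ⟨_, rfl⟩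
  have hp0 : 0 ≤ p := by rw [hpd]; positivity
  have h1 : d ^ (δ - 1) * Real.exp (s - d) = p * Real.exp s := by
    rw [hpd, mul_assoc, ← Real.exp_add, neg_add_eq_sub]
  rw [← hpd] at hp
  rw [h1]
  have h2 : p * y ^ 2 ≤ p * Real.exp s := mul_le_mul_of_nonneg_left hy hp0
  have h3 : 27 / 128 * y ^ 2 ≤ d * p * y ^ 2 := mul_le_mul_of_nonneg_right hp (sq_nonneg y)
  -- after multiplication by `d` the inequality is a complete square
  have h4 : 0 ≤ d * (4 * d + 8 / 3 * (p * y ^ 2) - 3 * y) := by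
    nlinarith [sq_nonneg (2 * d - 3 / 4 * y)]
  have h5 := nonneg_of_mul_nonneg_right h4 hd0
  linarith

end Numerics

/-! ### Poincaré inequalities for evolved product states -/

section Poincare

open scoped Matrix.Norms.L2Operator

variable {V : Type*} [Fintype V] [DecidableEq V] {q : ℕ}

omit [DecidableEq V] in
theorem IsProductState.exists_eq_tensor {ρ : Op V q} (hρ : IsProductState ρ) :
    ∃ r : V → Matrix (Fin q) (Fin q) ℂ, (∀ v, IsState (r v)) ∧ ρ = tensor r := by
  obtain ⟨r, hr, h⟩ := hρ
  exact ⟨r, hr, by ext σ τ; exact h σ τ⟩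

theorem IsState.neZero {r : Matrix (Fin q) (Fin q) ℂ} (hr : IsState r) : NeZero q := by
  refine ⟨fun h => ?_⟩
  subst h
  have := hr.2
  simp [Matrix.trace] at this

theorem variance_evolve {U ρ : Op V q} (hU : U ∈ Matrix.unitaryGroup (V → Fin q) ℂ) (O : Op V q) :
    variance (evolve U ρ) O = variance ρ (Uᴴ * O * U) := by
  have h1 : Uᴴ * U = 1 := (Unitary.mem_iff.1 hU).1
  have h2 : U * Uᴴ = 1 := (Unitary.mem_iff.1 hU).2
  have htr : ∀ X : Op V q, (evolve U ρ * X).trace = (ρ * (Uᴴ * X * U)).trace := by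
    intro X
    rw [evolve, mul_assoc, mul_assoc, Matrix.trace_mul_comm]
    simp only [mul_assoc]
  rw [variance, variance, htr, htr O]
  obtain ⟨c, hc⟩ : ∃ c, c = (ρ * (Uᴴ * O * U)).trace := ⟨_, rfl⟩
  rw [← hc]
  have h3 : Uᴴ * O * U - c • (1 : Op V q) = Uᴴ * (O - c • (1 : Op V q)) * U := by
    rw [mul_sub, sub_mul, mul_smul_comm, smul_mul_assoc, mul_one, h1]
  have h4 : ∀ X : Op V q, Uᴴ * (Xᴴ * X) * U = (Uᴴ * X * U)ᴴ * (Uᴴ * X * U) := by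
    intro X
    simp only [Matrix.conjTranspose_mul, Matrix.conjTranspose_conjTranspose, mul_assoc]
    rw [← mul_assoc U Uᴴ, h2, one_mul]
  rw [h3, h4]

theorem poincareTwoInfty_of_le {ρ : Op V q} (hρ : IsProductState ρ) {U : Op V q}
    (hU : U ∈ Matrix.unitaryGroup (V → Fin q) ℂ) {A : ℝ} (hA : 0 < A)
    (h : ∀ O : Op V q, ∀ w, ∃ X, TrivialAt w X ∧ ‖Uᴴ * O * U - X‖ ≤ A * lipschitzConst O) :
    PoincareTwoInfty (evolve U ρ) (A ^ 2) := by
  refine ⟨by positivity, fun O _ => ?_⟩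
  obtain ⟨r, hr, rfl⟩ := hρ.exists_eq_tensor
  choose X hX hXle using h O
  rw [variance_evolve hU]
  refine (variance_tensor_le hr _ hX).trans ?_
  calc ∑ w, ‖Uᴴ * O * U - X w‖ ^ 2 ≤ ∑ _w : V, (A * lipschitzConst O) ^ 2 :=
        Finset.sum_le_sum fun w _ => pow_le_pow_left₀ (norm_nonneg _) (hXle w) 2
    _ = _ := by rw [Finset.sum_const, Finset.card_univ, nsmul_eq_mul]; ring

/-- The Poincaré inequality with a constant independent of the time, which follows from the
distance to the scalars. -/
theorem poincareTwoInfty_card_sq {ρ : Op V q} (hρ : IsProductState ρ) {U : Op V q}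
    (hU : U ∈ Matrix.unitaryGroup (V → Fin q) ℂ) [Nonempty V] :
    PoincareTwoInfty (evolve U ρ) ((Fintype.card V : ℝ) ^ 2) := by
  obtain ⟨r, hr, -⟩ := hρ.exists_eq_tensor
  have := (hr (Classical.arbitrary V)).neZero
  refine poincareTwoInfty_of_le hρ hU (Nat.cast_pos.2 Fintype.card_pos) fun O w => ?_
  obtain ⟨c, hc⟩ := exists_norm_sub_smul_one_le O
  refine ⟨c • 1, fun A => (Commute.one_left _).smul_left _, ?_⟩
  have h1 : Uᴴ * U = 1 := (Unitary.mem_iff.1 hU).1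
  have h3 : Uᴴ * O * U - c • (1 : Op V q) = Uᴴ * (O - c • (1 : Op V q)) * U := by
    rw [mul_sub, sub_mul, mul_smul_comm, smul_mul_assoc, mul_one, h1]
  rw [h3, CStarRing.norm_mul_mem_unitary _ hU, ← Matrix.star_eq_conjTranspose,
    CStarRing.norm_mem_unitary_mul _ (Unitary.star_mem hU)]
  exact hc

/-- The Poincaré inequality whose constant grows exponentially in time, from the growth of the
commutators of the observable with unitaries at a site. -/
theorem IsLocalProcess.poincareTwoInfty_exp {G : SimpleGraph V} [DecidableRel G.Adj]
    {h : Sym2 V → Op V q} {α : Sym2 V → ℝ → ℝ} {b : ℝ} {U : ℝ → Op V q}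
    (hU : IsLocalProcess G h α b U) (hG : G.Connected) [Nontrivial V] {ρ : Op V q}
    (hρ : IsProductState ρ) {t : ℝ} (ht : 0 ≤ t) :
    PoincareTwoInfty (evolve (U t) ρ)
      ((3 * Real.exp (b * (2 * G.maxDegree - 1) * t)) ^ 2) := by
  obtain ⟨r, hr, -⟩ := hρ.exists_eq_tensor
  have := (hr (Classical.arbitrary V)).neZero
  refine poincareTwoInfty_of_le hρ (hU.evolution.unitary t ht) (by positivity) fun O w =>
    ⟨twirl w ((U t)ᴴ * O * U t), twirl_trivialAt _ _, ?_⟩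
  have hO : CommutatorBound G O (3 * lipschitzConst O) := by
    intro e _ K hK
    induction e using Sym2.ind with
    | h u v => exact norm_commutator_le_lipschitzConst hK O
  have hm : 0 ≤ 3 * lipschitzConst O := mul_nonneg (by norm_num) (lipschitzConst_nonneg O)
  have hO' := hU.commutatorBound hm ht hO
  obtain ⟨u, hu⟩ := hG.preconnected.exists_adj_of_nontrivial w
  refine norm_sub_twirl_le_of_commutator fun p => ?_
  refine (hO' s(w, u) hu _ (siteOp_actsOn (Sym2.mem_mk_left w u) _)).trans ?_
  have h1 := norm_le_one_of_mem_unitaryGroup (siteOp_signShift_mem_unitary w p)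
  refine (mul_le_of_le_one_right (by positivity) h1).trans (le_of_eq ?_)
  ring

end Poincare

end LocalQuantum

end

theorem mainTheorem6 {V : Type*} [Fintype V] [DecidableEq V] (q : ℕ)
    (G : SimpleGraph V) [DecidableRel G.Adj] (hG : G.Connected)
    (δ M : ℝ) (hδ : 1 ≤ δ) (hM : 0 < M) (hdim : LocalQuantum.HasSpatialDim G δ M)
    (h : Sym2 V → LocalQuantum.Op V q) (α : Sym2 V → ℝ → ℝ) (b : ℝ)
    (U : ℝ → LocalQuantum.Op V q) (hU : LocalQuantum.IsLocalProcess G h α b U)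
    (v₀ : V) (x : Fin (Fintype.card V) ≃ V) (hx : LocalQuantum.IsDistanceOrdering G v₀ x)
    (ρ : LocalQuantum.Op V q) (hρ : LocalQuantum.IsProductState ρ)
    (t : ℝ) (ht : 0 ≤ t) :
    ∃ C : ℝ,
      C ≤ 4 * (2 * ((LocalQuantum.firstFarLabel G v₀ x δ : ℝ) - 1)
        + 4 * M / (2 * (G.maxDegree : ℝ) - 1) *
          ∑ i ∈ Finset.Icc (LocalQuantum.firstFarLabel G v₀ x δ) (Fintype.card V),
            (LocalQuantum.labelDist G v₀ x i : ℝ) ^ (δ - 1) *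
              Real.exp (LocalQuantum.lrVelocity G.maxDegree b * t
                - (LocalQuantum.labelDist G v₀ x i : ℝ))) ^ 2 ∧
      LocalQuantum.PoincareTwoInfty (LocalQuantum.evolve (U t) ρ) C := by
  have hne : Nonempty V := ⟨v₀⟩
  have h2 := LocalQuantum.two_le_firstFarLabel hx hδ
  have hUt := hU.evolution.unitary t ht
  have hmem := LocalQuantum.firstFarLabel_mem (G := G) (v₀ := v₀) x δ
  obtain ⟨S, hS⟩ : ∃ S, S = ∑ i ∈ Finset.Icc (LocalQuantum.firstFarLabel G v₀ x δ)
      (Fintype.card V), (LocalQuantum.labelDist G v₀ x i : ℝ) ^ (δ - 1) *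
        Real.exp (LocalQuantum.lrVelocity G.maxDegree b * t
          - (LocalQuantum.labelDist G v₀ x i : ℝ)) := ⟨_, rfl⟩
  have hS0 : 0 ≤ S := by
    rw [hS]
    exact Finset.sum_nonneg fun i _ => by positivity
  rw [← hS]
  have h2r : (2 : ℝ) ≤ (LocalQuantum.firstFarLabel G v₀ x δ : ℝ) := by exact_mod_cast h2
  rcases hmem with ⟨-, hle, hfar⟩ | hlast
  · have hnt : Nontrivial V := Fintype.one_lt_card_iff_nontrivial.1 (by omega)
    have hD1 : 1 ≤ G.maxDegree :=
      (hG.preconnected.degree_pos_of_nontrivial v₀).trans_le (G.degree_le_maxDegree v₀)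
    have hD1r : (1 : ℝ) ≤ G.maxDegree := by exact_mod_cast hD1
    by_cases hD : G.maxDegree ≤ 1
    · refine ⟨_, ?_, LocalQuantum.poincareTwoInfty_card_sq hρ hUt⟩
      have hc : (Fintype.card V : ℝ) ≤ 2 := by
        exact_mod_cast LocalQuantum.card_le_two_of_maxDegree_le_one hG hD
      have hT : 0 ≤ 4 * M / (2 * (G.maxDegree : ℝ) - 1) * S :=
        mul_nonneg (div_nonneg (by linarith) (by linarith)) hS0
      have hc0 : (0 : ℝ) ≤ Fintype.card V := Nat.cast_nonneg _
      nlinarith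
    · refine ⟨_, ?_, hU.poincareTwoInfty_exp hG hρ ht⟩
      have hD2 : (2 : ℝ) ≤ G.maxDegree := by
        have : 2 ≤ G.maxDegree := by omega
        exact_mod_cast this
      obtain ⟨u, hu⟩ := hG.preconnected.exists_adj_of_nontrivial v₀
      have hb : 0 ≤ b := (abs_nonneg _).trans (hU.coupling_le s(v₀, u) hu 0 le_rfl)
      obtain ⟨d, hd⟩ : ∃ d, d = LocalQuantum.labelDist G v₀ x
          (LocalQuantum.firstFarLabel G v₀ x δ) := ⟨_, rfl⟩
      have hd1 : 1 ≤ d := by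
        rw [← hd] at hfar
        have : (1 : ℝ) ≤ d := by linarith
        exact_mod_cast this
      have hd1r : (1 : ℝ) ≤ d := by exact_mod_cast hd1
      have hdδ : (d : ℝ) ≤ 2 * δ := by
        rw [hd]
        exact (LocalQuantum.labelDist_firstFarLabel_lt hG hx hle (by omega) (hd ▸ hd1)).le
      have hdi : (d : ℝ) ≤ (LocalQuantum.firstFarLabel G v₀ x δ : ℝ) - 1 := by
        have := LocalQuantum.labelDist_firstFarLabel_le hG hx hle (by omega)
        rw [← hd] at this
        have h3 : d + 1 ≤ LocalQuantum.firstFarLabel G v₀ x δ := by omega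
        have h4 : ((d + 1 : ℕ) : ℝ) ≤ (LocalQuantum.firstFarLabel G v₀ x δ : ℝ) :=
          Nat.cast_le.2 h3
        push_cast at h4
        linarith
      have hMD : 4 / 3 ≤ 4 * M / (2 * (G.maxDegree : ℝ) - 1) := by
        have := hdim.maxDegree_sub_one_le hD1
        rw [le_div_iff₀ (by linarith)]
        linarith
      obtain ⟨s, hs⟩ : ∃ s, s = LocalQuantum.lrVelocity G.maxDegree b * t := ⟨_, rfl⟩
      -- here the factor `e` of the velocity is used, in the form `2 ≤ e`
      have hy : Real.exp (b * (2 * G.maxDegree - 1) * t) ^ 2 ≤ Real.exp s := by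
        rw [← Real.exp_nat_mul, Real.exp_le_exp, hs, LocalQuantum.lrVelocity]
        have he : (2 : ℝ) ≤ Real.exp 1 := by
          have := Real.add_one_le_exp (1 : ℝ)
          linarith
        have hbt : 0 ≤ b * (2 * (G.maxDegree : ℝ) - 1) * t :=
          mul_nonneg (mul_nonneg hb (by linarith)) ht
        have := mul_le_mul_of_nonneg_right he hbt
        push_cast
        linarith
      have hSge : (d : ℝ) ^ (δ - 1) * Real.exp (s - d) ≤ S := by
        rw [hS, hd, hs]
        exact Finset.single_le_sum (f := fun i => (LocalQuantum.labelDist G v₀ x i : ℝ) ^ (δ - 1) *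
          Real.exp (LocalQuantum.lrVelocity G.maxDegree b * t
            - (LocalQuantum.labelDist G v₀ x i : ℝ))) (fun i _ => by positivity)
          (Finset.mem_Icc.2 ⟨le_rfl, hle⟩)
      have hkey := LocalQuantum.three_mul_le hd1r hdδ hy
      have hprod : 4 / 3 * S ≤ 4 * M / (2 * (G.maxDegree : ℝ) - 1) * S :=
        mul_le_mul_of_nonneg_right hMD hS0
      have hfin : 3 * Real.exp (b * (2 * G.maxDegree - 1) * t) ≤
          2 * (2 * ((LocalQuantum.firstFarLabel G v₀ x δ : ℝ) - 1) +
            4 * M / (2 * (G.maxDegree : ℝ) - 1) * S) := by linarith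
      refine (pow_le_pow_left₀ (by positivity) hfin 2).trans (le_of_eq ?_)
      ring
  · refine ⟨_, ?_, LocalQuantum.poincareTwoInfty_card_sq hρ hUt⟩
    rw [Set.mem_singleton_iff] at hlast
    have hS' : S = 0 := by
      rw [hS, hlast, Finset.Icc_eq_empty (by omega), Finset.sum_empty]
    rw [hS', hlast]
    push_cast
    have hc0 : (0 : ℝ) ≤ Fintype.card V := Nat.cast_nonneg _
    nlinarith
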